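/- **Theorem (sufficient second-order optimality conditions).** Let $d\in\{2,3\}$, let $\Omega\subset\mathbb{R}^d$ be a bounded domain with Lipschitz boundary, and let $\alpha>0$, $0<\mathsf a<\mathsf b$, $\mathbf f\in\mathbf H^{-1}(\Omega)=\mathbf H_0^1(\Omega)'$, $\mathbf y_\Omega\in\mathbf L^2(\Omega)$. Set $$L_0^2(\Omega)=\Big\{q\in L^2(\Omega):\int_\Omega q=0\Big\},\quad \mathbf V(\Omega)=\{\mathbf v\in\mathbf H_0^1(\Omega):\operatorname{div}\mathbf v=0\},\quad \mathbb U_{ad}=\{v\in L^2(\Omega):\mathsf a\le v\le\mathsf b\text{ a.e. in }\Omega\}.$$ Let $\mathcal U$ be the set of all $u\in L^\infty(\Omega)$ that are bounded below a.e. by some positive constant. For $u\in\mathcal U$ let $\mathcal G u=\mathbf y$ be the velocity field of the Stokes--Brinkman equations $-\Delta\mathbf y+u\mathbf y+\nabla\mathsf p=\mathbf f$, $\operatorname{div}\mathbf y=0$ in $\Omega$, $\mathbf y=0$ on $\partial\Omega$, that is, the unique $\mathbf y\in\mathbf V(\Omega)$ with $$(\nabla\mathbf y,\nabla\mathbf v)_{\mathbf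 L^2(\Omega)}+(u\mathbf y,\mathbf v)_{\mathbf L^2(\Omega)}=\langle\mathbf f,\mathbf v\rangle\qquad\forall\,\mathbf v\in\mathbf V(\Omega),$$ and let $$j(u)=\tfrac12\|\mathcal G u-\mathbf y_\Omega\|_{\mathbf L^2(\Omega)}^2+\tfrac\alpha2\|u\|_{L^2(\Omega)}^2 .$$ For $v\in L^\infty(\Omega)$ let $j''(u)v^2$ be the second Fréchet derivative of $j$ at $u$ with respect to the $L^\infty(\Omega)$-topology, evaluated at $(v,v)$; for $v\in L^2(\Omega)$ let $j''(u)v^2$ be its extension by continuity in the $L^2(\Omega)$-norm. Let $(\bar u,\bar{\mathbf y},\bar{\mathbf z})\in\mathbb U_{ad}\times\mathbf H_0^1(\Omega)\times\mathbf H_0^1(\Omega)$ satisfy the following first-order optimality conditions: there are $\bar{\mathsf p},\bar{\mathsf r}\in L_0^2(\Omega)$ such that, for all $\mathbf v\in\mathbf H_0^1(\Omega)$ and all $\mathsf q\in L_0^2(\Omega)$, $$(\nabla\bar{\mathbf y},\nabla\mathbf v)_{\mathbf L^2(\Omega)}+(\bar u\bar{\mathbf y},\mathbf v)_{\mathbf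 L^2(\Omega)}-(\bar{\mathsf p},\operatorname{div}\mathbf v)_{L^2(\Omega)}=\langle\mathbf f,\mathbf v\rangle,\qquad(\mathsf q,\operatorname{div}\bar{\mathbf y})_{L^2(\Omega)}=0,$$ $$(\nabla\mathbf v,\nabla\bar{\mathbf z})_{\mathbf L^2(\Omega)}+(\bar u\bar{\mathbf z},\mathbf v)_{\mathbf L^2(\Omega)}+(\bar{\mathsf r},\operatorname{div}\mathbf v)_{L^2(\Omega)}=(\bar{\mathbf y}-\mathbf y_\Omega,\mathbf v)_{\mathbf L^2(\Omega)},\qquad(\mathsf q,\operatorname{div}\bar{\mathbf z})_{L^2(\Omega)}=0,$$ and, with $\bar{\mathfrak d}:=\alpha\bar u-\bar{\mathbf y}\cdot\bar{\mathbf z}$, $$\int_\Omega\bar{\mathfrak d}\,(u-\bar u)\,\mathrm dx\ge0\qquad\forall\,u\in\mathbb U_{ad}.$$ Let $C_{\bar u}$ be the set of all $v\in L^2(\Omega)$ such that, for a.e. $x\in\Omega$: $v(x)\ge0$ if $\bar u(x)=\mathsf a$, $v(x)\le0$ if $\bar u(x)=\mathsf b$, and $v(x)=0$ if $\bar{\mathfrak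 d}(x)\ne0$. If $j''(\bar u)v^2>0$ for all $v\in C_{\bar u}\setminus\{0\}$, then there exist $\delta>0$ and $\sigma>0$ such that $$j(u)\ge j(\bar u)+\frac\sigma2\|u-\bar u\|_{L^2(\Omega)}^2\qquad\text{for all }u\in\mathbb U_{ad}\text{ with }\|u-\bar u\|_{L^2(\Omega)}\le\delta .$$ -/

import Mathlib

open MeasureTheory

noncomputable section

namespace BilinearStokesBrinkman

/-- Points of `ℝ^d`, and values of vector fields, with the Euclidean norm. -/
abbrev Vec (d : ℕ) : Type := EuclideanSpace ℝ (Fin d)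

/-- Lipschitz boundary: near each boundary point, `Ω` is the strict epigraph, in the direction of
some unit vector `n`, of a Lipschitz function of the component of `x` orthogonal to `n`. -/
def HasLipschitzBoundary {d : ℕ} (Ω : Set (Vec d)) : Prop :=
  ∀ x₀ ∈ frontier Ω, ∃ r > 0, ∃ n : Vec d, ‖n‖ = 1 ∧
    ∃ (K : NNReal) (g : Vec d → ℝ), LipschitzWith K g ∧
      ∀ x ∈ Metric.ball x₀ r, x ∈ Ω ↔ g (x - inner ℝ n x • n) < inner ℝ n x

/-- An open, bounded, connected, nonempty set with Lipschitz boundary. -/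
structure IsLipschitzDomain {d : ℕ} (Ω : Set (Vec d)) : Prop where
  isOpen : IsOpen Ω
  isBounded : Bornology.IsBounded Ω
  isConnected : IsConnected Ω
  lipschitz : HasLipschitzBoundary Ω

/-! ### Function spaces -/

/-- The scalar space `L^2(Ω)`. -/
abbrev L2 {d : ℕ} (Ω : Set (Vec d)) : Type := Lp ℝ 2 (volume.restrict Ω)

/-- The scalar space `L^∞(Ω)`. -/
abbrev LInf {d : ℕ} (Ω : Set (Vec d)) : Type := Lp ℝ ⊤ (volume.restrict Ω)

/-- The space `L^2(Ω; ℝ^d)` of vector fields. -/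
abbrev L2Vec {d : ℕ} (Ω : Set (Vec d)) : Type := Lp (Vec d) 2 (volume.restrict Ω)

/-- Pairs `(y, (∂₁y, …, ∂_d y))` in `L^2(Ω; ℝ^d) × L^2(Ω; ℝ^d)^d`, a Hilbert space whose norm
restricts to the `H^1` norm `(‖y‖^2 + ‖∇y‖^2)^(1/2)`. -/
abbrev L2Jet {d : ℕ} (Ω : Set (Vec d)) : Type :=
  WithLp 2 (L2Vec Ω × PiLp 2 (fun _ : Fin d => L2Vec Ω))

/-- `φ ∈ C_c^∞(Ω; ℝ^d)`. -/
def IsTestField {d : ℕ} (Ω : Set (Vec d)) (φ : Vec d → Vec d) : Prop :=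
  ContDiff ℝ (⊤ : ℕ∞) φ ∧ HasCompactSupport φ ∧ tsupport φ ⊆ Ω

/-- `w = (φ, ∇φ)` as classes of functions on `Ω`. -/
def IsJetOf {d : ℕ} (Ω : Set (Vec d)) (w : L2Jet Ω) (φ : Vec d → Vec d) : Prop :=
  w.fst =ᵐ[volume.restrict Ω] φ ∧
    ∀ i : Fin d, w.snd i =ᵐ[volume.restrict Ω]
      fun x => fderiv ℝ φ x (EuclideanSpace.single i 1)

/-- The subspace `{(φ, ∇φ) : φ ∈ C_c^∞(Ω; ℝ^d)}`. -/
def testJets {d : ℕ} (Ω : Set (Vec d)) : Submodule ℝ (L2Jet Ω) where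
  carrier := {w | ∃ φ, IsTestField Ω φ ∧ IsJetOf Ω w φ}
  zero_mem' := by
    refine ⟨0, ⟨contDiff_const, HasCompactSupport.zero, by simp⟩, Lp.coeFn_zero _ _ _, fun i => ?_⟩
    refine (Lp.coeFn_zero _ _ _).trans (Filter.Eventually.of_forall fun x => ?_)
    simp
  add_mem' := by
    rintro w w' ⟨φ, ⟨hs, hc, ht⟩, h0, h1⟩ ⟨φ', ⟨hs', hc', ht'⟩, h0', h1'⟩
    refine ⟨φ + φ', ⟨hs.add hs', hc.add hc', (tsupport_add φ φ').trans (Set.union_subset ht ht')⟩,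
      ?_, fun i => ?_⟩
    · exact (Lp.coeFn_add _ _).trans (h0.add h0')
    · refine (Lp.coeFn_add _ _).trans (((h1 i).add (h1' i)).trans
        (Filter.Eventually.of_forall fun x => ?_))
      have hd : DifferentiableAt ℝ φ x := hs.differentiable (by simp) x
      have hd' : DifferentiableAt ℝ φ' x := hs'.differentiable (by simp) x
      simp [fderiv_add hd hd']
  smul_mem' := by
    rintro c w ⟨φ, ⟨hs, hc, ht⟩, h0, h1⟩
    refine ⟨c • φ, ⟨hs.const_smul c, hc.mono (Function.support_const_smul_subset c φ),
      (closure_mono (Function.support_const_smul_subset c φ)).trans ht⟩, ?_, fun i => ?_⟩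
    · exact (Lp.coeFn_smul _ _).trans (h0.const_smul c)
    · refine (Lp.coeFn_smul _ _).trans (((h1 i).const_smul c).trans
        (Filter.Eventually.of_forall fun x => ?_))
      have hd : DifferentiableAt ℝ φ x := hs.differentiable (by simp) x
      simp [fderiv_const_smul hd]

/-- `H_0^1(Ω; ℝ^d)`: the closure of `C_c^∞(Ω; ℝ^d)` in the `H^1` norm. An element is a vector field
together with its weak partial derivatives, which it determines. -/
abbrev H10 {d : ℕ} (Ω : Set (Vec d)) : Type :=
  ((testJets Ω).topologicalClosure : Submodule ℝ (L2Jet Ω))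

/-- The vector field underlying an element of `H_0^1(Ω; ℝ^d)`. -/
def H10.field {d : ℕ} {Ω : Set (Vec d)} (y : H10 Ω) : L2Vec Ω := y.1.fst

/-- The weak partial derivative `∂_i y`. -/
def H10.partialD {d : ℕ} {Ω : Set (Vec d)} (y : H10 Ω) (i : Fin d) : L2Vec Ω := y.1.snd i

/-- The divergence `∑_i ∂_i y_i`. -/
def H10.div {d : ℕ} {Ω : Set (Vec d)} (y : H10 Ω) : Vec d → ℝ := fun x => ∑ i, y.partialD i x i

/-- `V(Ω)`: the divergence-free elements of `H_0^1(Ω; ℝ^d)`. -/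
def divFree {d : ℕ} (Ω : Set (Vec d)) : Set (H10 Ω) := {y | y.div =ᵐ[volume.restrict Ω] 0}

/-- `L_0^2(Ω)`: the elements of `L^2(Ω)` with zero mean. -/
def L20 {d : ℕ} (Ω : Set (Vec d)) : Set (L2 Ω) := {q | ∫ x in Ω, q x = 0}

/-- `H^{-1}(Ω)`: the dual of `H_0^1(Ω; ℝ^d)`. -/
abbrev HNegOne {d : ℕ} (Ω : Set (Vec d)) : Type := H10 Ω →L[ℝ] ℝ

/-! ### State and adjoint equations -/

/-- `(∇y, ∇v) + (u y, v)`, for a coefficient `u`. -/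
def brinkmanForm {d : ℕ} {Ω : Set (Vec d)} (u : Vec d → ℝ) (y v : H10 Ω) : ℝ :=
  (∑ i, ∫ x in Ω, inner ℝ (y.partialD i x) (v.partialD i x)) +
    ∫ x in Ω, u x * inner ℝ (y.field x) (v.field x)

/-- The pair `(y, p) ∈ H_0^1 × L_0^2` solves the weak state equations with control `u`. -/
def SolvesState {d : ℕ} {Ω : Set (Vec d)} (f : HNegOne Ω) (u : Vec d → ℝ)
    (y : H10 Ω) (p : L2 Ω) : Prop :=
  p ∈ L20 Ω ∧
    (∀ v : H10 Ω, brinkmanForm u y v - ∫ x in Ω, p x * v.div x = f v) ∧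
    ∀ q ∈ L20 Ω, ∫ x in Ω, q x * y.div x = 0

/-- The pair `(z, r) ∈ H_0^1 × L_0^2` solves the weak adjoint equations with control `u` and
velocity field `y`. -/
def SolvesAdjoint {d : ℕ} {Ω : Set (Vec d)} (yΩ : L2Vec Ω) (u : Vec d → ℝ) (y : H10 Ω)
    (z : H10 Ω) (r : L2 Ω) : Prop :=
  r ∈ L20 Ω ∧
    (∀ v : H10 Ω, brinkmanForm u v z + ∫ x in Ω, r x * v.div x =
      ∫ x in Ω, inner ℝ (y.field x - yΩ x) (v.field x)) ∧
    ∀ s ∈ L20 Ω, ∫ x in Ω, s x * z.div x = 0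

/-- The pressure-free weak formulation of the state equations: `y` is divergence-free and the
equation is tested with divergence-free fields. -/
def SolvesReducedState {d : ℕ} {Ω : Set (Vec d)} (f : HNegOne Ω) (u : Vec d → ℝ)
    (y : H10 Ω) : Prop :=
  y ∈ divFree Ω ∧ ∀ v ∈ divFree Ω, brinkmanForm u y v = f v

open Classical in
/-- The map `𝒢 : u ↦ y` from a control to its velocity field. For `u ∈ L^∞(Ω)` bounded below by a
positive constant, `y` exists and is unique; otherwise the value may be meaningless. -/
def controlToVelocity {d : ℕ} {Ω : Set (Vec d)} (f : HNegOne Ω) (u : Vec d → ℝ) : H10 Ω :=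
  if h : ∃ y : H10 Ω, SolvesReducedState f u y then h.choose else 0

/-! ### The control problem -/

/-- The admissible controls: `a ≤ u ≤ b` almost everywhere in `Ω`. -/
def admissible {d : ℕ} (Ω : Set (Vec d)) (a b : ℝ) : Set (L2 Ω) :=
  {u | ∀ᵐ x ∂(volume.restrict Ω), a ≤ u x ∧ u x ≤ b}

/-- The cost `J(y, u) = 1/2 ‖y - y_Ω‖^2 + α/2 ‖u‖^2`. -/
def cost {d : ℕ} {Ω : Set (Vec d)} (α : ℝ) (yΩ : L2Vec Ω) (y : H10 Ω) (u : Vec d → ℝ) : ℝ :=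
  1 / 2 * ‖y.field - yΩ‖ ^ 2 + α / 2 * ∫ x in Ω, u x ^ 2

/-- The reduced cost `j(u) = J(𝒢 u, u)`. -/
def reducedCost {d : ℕ} {Ω : Set (Vec d)} (f : HNegOne Ω) (α : ℝ) (yΩ : L2Vec Ω)
    (u : Vec d → ℝ) : ℝ :=
  cost α yΩ (controlToVelocity f u) u

/-- The second Fréchet derivative `j''(u)(v, v)` with respect to the `L^∞(Ω)` topology, for
`v ∈ L^∞(Ω)`: that of `h ↦ j(u + h)`, `h ∈ L^∞(Ω)`, at `h = 0`. -/
def secondDerivLInf {d : ℕ} {Ω : Set (Vec d)} (f : HNegOne Ω) (α : ℝ) (yΩ : L2Vec Ω)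
    (u : Vec d → ℝ) (v : LInf Ω) : ℝ :=
  fderiv ℝ (fderiv ℝ fun h : LInf Ω => reducedCost f α yΩ fun x => u x + h x) 0 v v

open Classical in
/-- `j''(u)v^2` for `v ∈ L^2(Ω)`: the extension of `v ↦ j''(u)(v, v)` from `L^∞(Ω)` to `L^2(Ω)` by
`L^2`-continuity. -/
def secondDeriv {d : ℕ} {Ω : Set (Vec d)} (f : HNegOne Ω) (α : ℝ) (yΩ : L2Vec Ω)
    (u : Vec d → ℝ) : L2 Ω → ℝ :=
  extendFrom {v : L2 Ω | MemLp v ⊤ (volume.restrict Ω)} fun v =>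
    if h : MemLp v ⊤ (volume.restrict Ω) then secondDerivLInf f α yΩ u (h.toLp v) else 0

/-- The function `𝔡 = α u - y · z`. -/
def reducedGradient {d : ℕ} {Ω : Set (Vec d)} (α : ℝ) (u : L2 Ω) (y z : H10 Ω) : Vec d → ℝ :=
  fun x => α * u x - inner ℝ (y.field x) (z.field x)

/-- The first-order conditions for `(u, y, z)`: state equations, adjoint equations (each with some
pressure), and variational inequality. -/
def FirstOrderConditions {d : ℕ} {Ω : Set (Vec d)} (f : HNegOne Ω) (α : ℝ) (yΩ : L2Vec Ω)
    (a b : ℝ) (u : L2 Ω) (y z : H10 Ω) : Prop :=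
  (∃ p : L2 Ω, SolvesState f u y p) ∧
    (∃ r : L2 Ω, SolvesAdjoint yΩ u y z r) ∧
    ∀ w ∈ admissible Ω a b, 0 ≤ ∫ x in Ω, reducedGradient α u y z x * (w x - u x)

/-- The cone `C_u` of critical directions. -/
def criticalCone {d : ℕ} {Ω : Set (Vec d)} (α a b : ℝ) (u : L2 Ω) (y z : H10 Ω) : Set (L2 Ω) :=
  {v | ∀ᵐ x ∂(volume.restrict Ω),
    (u x = a → 0 ≤ v x) ∧ (u x = b → v x ≤ 0) ∧ (reducedGradient α u y z x ≠ 0 → v x = 0)}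

end BilinearStokesBrinkman

end

open MeasureTheory Filter Topology

open scoped RealInnerProductSpace ENNReal NNReal

set_option maxSynthPendingDepth 3

set_option linter.unusedSectionVars false

/-! ### Weak sequential convergence and quadratic growth in Hilbert spaces -/

/-! For `d = 2, 3` one has `H_0^1 ⊂ L⁴`, so `y · v` is in `L²` for fields `y, v` in `H_0^1`, and the
control enters the weak state equation through a bounded form `⟪h, P y v⟫` with `h` merely in `L²`.
Tested with divergence-free fields, the operator at `ubar` is an isomorphism onto the dual, and it
remains one under every perturbation `h` that is small in `L²`. Hence there is no two-norm
discrepancy: around `ubar` the cost is smooth in the `L²` topology.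

The adjoint equation gives `j(ubar + h) = j(ubar) + (𝔡, h) + ½(α‖h‖² + K h) + O(‖h‖³)`, where `K h =
‖η‖² - 2⟪h, η · z⟫` and `η` is the linearized state (`exists_perturbedCost_expansion`). Its
quadratic part is `j''(ubar)` on `L^∞` by uniqueness of Taylor coefficients, and on `L²` by density
(`secondDeriv_eq`). By Rellich's theorem and compactness of multiplication by `z`, `K` is weakly
sequentially continuous.

Were quadratic growth to fail, controls `u n → ubar` violating it would give unit directions with a
weak limit `v₀`. This limit is critical (`mem_criticalCone_of_weakTendsto`), and `α + K v₀ ≤ 0`. As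
`‖v₀‖ ≤ 1`, positivity on the cone forces `v₀ = 0`, hence `α ≤ 0`, a contradiction
(`quadratic_growth`). -/

/-- Weak convergence of a sequence in a real inner product space. -/
def WeakTendsto {E : Type*} [NormedAddCommGroup E] [InnerProductSpace ℝ E]
    (x : ℕ → E) (x₀ : E) : Prop :=
  ∀ w : E, Tendsto (fun n => ⟪w, x n⟫) atTop (𝓝 ⟪w, x₀⟫)

section WeakConvergence

variable {E F : Type*} [NormedAddCommGroup E] [InnerProductSpace ℝ E]
  [NormedAddCommGroup F] [InnerProductSpace ℝ F]

theorem WeakTendsto.map [CompleteSpace E] [CompleteSpace F] {x : ℕ → E} {x₀ : E}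
    (h : WeakTendsto x x₀) (T : E →L[ℝ] F) : WeakTendsto (fun n => T (x n)) (T x₀) := by
  intro w
  simpa [ContinuousLinearMap.adjoint_inner_left] using h (ContinuousLinearMap.adjoint T w)

theorem WeakTendsto.sub_const {x : ℕ → E} {x₀ : E} (h : WeakTendsto x x₀) :
    WeakTendsto (fun n => x n - x₀) 0 := by
  intro w
  simpa [inner_sub_right] using (h w).sub_const ⟪w, x₀⟫

theorem WeakTendsto.clm [CompleteSpace E] {x : ℕ → E} {x₀ : E} (h : WeakTendsto x x₀)
    (l : E →L[ℝ] ℝ) : Tendsto (fun n => l (x n)) atTop (𝓝 (l x₀)) := by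
  simpa using h ((InnerProductSpace.toDual ℝ E).symm l)

/-- Weak lower semicontinuity of the norm: test the convergence with `x₀` itself. -/
theorem WeakTendsto.norm_le {x : ℕ → E} {x₀ : E} (h : WeakTendsto x x₀) {M : ℝ}
    (hM : ∀ n, ‖x n‖ ≤ M) : ‖x₀‖ ≤ M := by
  have h1 : ‖x₀‖ * ‖x₀‖ ≤ ‖x₀‖ * M := by
    rw [← real_inner_self_eq_norm_mul_norm]
    exact le_of_tendsto (h x₀) (Eventually.of_forall fun n =>
      (real_inner_le_norm _ _).trans (mul_le_mul_of_nonneg_left (hM n) (norm_nonneg _)))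
  rcases (norm_nonneg x₀).eq_or_lt with h0 | h0
  · rw [← h0]; exact (norm_nonneg _).trans (hM 0)
  · exact le_of_mul_le_mul_left h1 h0

theorem WeakTendsto.isBounded [CompleteSpace E] {x : ℕ → E} {x₀ : E} (h : WeakTendsto x x₀) :
    ∃ M, ∀ n, ‖x n‖ ≤ M := by
  have key := banach_steinhaus (𝕜 := ℝ) (𝕜₂ := ℝ) (σ₁₂ := RingHom.id ℝ)
    (g := fun n => innerSL ℝ (x n)) (fun w => by
    obtain ⟨M, hM⟩ := (h w).norm.bddAbove_range
    refine ⟨M, fun n => ?_⟩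
    have := hM ⟨n, rfl⟩
    simpa [real_inner_comm] using this)
  simpa using key

/-- Bounded sequences in a separable Hilbert space have weakly convergent subsequences. -/
theorem exists_weakTendsto_subseq [CompleteSpace E] [TopologicalSpace.SeparableSpace E]
    {x : ℕ → E} {M : ℝ} (hM : ∀ n, ‖x n‖ ≤ M) :
    ∃ x₀ : E, ∃ φ : ℕ → ℕ, StrictMono φ ∧ WeakTendsto (fun n => x (φ n)) x₀ := by
  -- Sequential Banach–Alaoglu in the dual; the Riesz isomorphism brings the limit functional back
  -- to `E`.
  have hc := WeakDual.isSeqCompact_closedBall (𝕜 := ℝ) (E := E) 0 M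
  obtain ⟨l, -, φ, hφ, hl⟩ := hc (x := fun n => StrongDual.toWeakDual (innerSL ℝ (x n)))
    (fun n => by simpa using hM n)
  refine ⟨(InnerProductSpace.toDual ℝ E).symm (WeakDual.toStrongDual l), φ, hφ, fun w => ?_⟩
  have := (WeakDual.eval_continuous w).tendsto l |>.comp hl
  rw [real_inner_comm, InnerProductSpace.toDual_symm_apply]
  refine this.congr fun n => ?_
  simp [real_inner_comm]

/-- A function with a second-order expansion at `ubar` whose first-order part is nonnegative on
`S - ubar` and whose quadratic part is `α‖·‖²` plus a weakly continuous form grows quadratically on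
`S`, if its quadratic part is positive on the critical directions. -/
theorem quadratic_growth [CompleteSpace E] [TopologicalSpace.SeparableSpace E]
    {S C : Set E} {ubar : E} {j K : E → ℝ} {l : E →L[ℝ] ℝ} {α r c : ℝ} (hα : 0 < α) (hr : 0 < r)
    (hKsmul : ∀ (t : ℝ) (v : E), K (t • v) = t ^ 2 * K v)
    (hK : ∀ (x : ℕ → E) (v : E), WeakTendsto x v → Tendsto (fun n => K (x n)) atTop (𝓝 (K v)))
    (hj : ∀ h : E, ‖h‖ ≤ r →
      |j (ubar + h) - j ubar - (l h + 1 / 2 * (α * ‖h‖ ^ 2 + K h))| ≤ c * ‖h‖ ^ 3)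
    (hl : ∀ u ∈ S, 0 ≤ l (u - ubar))
    (hC : ∀ (u : ℕ → E) (t : ℕ → ℝ) (v : E), (∀ n, u n ∈ S) → (∀ n, 0 < t n) →
      WeakTendsto (fun n => t n • (u n - ubar)) v → l v = 0 → v ∈ C)
    (hpos : ∀ v ∈ C, v ≠ 0 → 0 < α * ‖v‖ ^ 2 + K v) :
    ∃ δ > 0, ∃ σ > 0, ∀ u ∈ S, ‖u - ubar‖ ≤ δ → j u ≥ j ubar + σ / 2 * ‖u - ubar‖ ^ 2 := by
  by_contra! hcon
  have hε : ∀ n : ℕ, (0 : ℝ) < min r (1 / ((n : ℝ) + 1)) := fun n =>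
    lt_min hr (by positivity)
  -- Both `δ` and `σ` shrink with `n`; the cap `r` keeps every `u n` where the expansion is valid.
  choose u huS hun hju using fun n : ℕ =>
    hcon (min r (1 / ((n : ℝ) + 1))) (hε n) (1 / ((n : ℝ) + 1)) (by positivity)
  have hne : ∀ n, 0 < ‖u n - ubar‖ := by
    intro n
    rw [norm_pos_iff]
    intro h0
    have := hju n
    rw [h0, sub_eq_zero.1 h0] at this
    simp at this
  set t : ℕ → ℝ := fun n => ‖u n - ubar‖ with ht
  set v : ℕ → E := fun n => (t n)⁻¹ • (u n - ubar) with hv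
  have hv1 : ∀ n, ‖v n‖ = 1 := fun n => by
    simp only [hv, ht, norm_smul, norm_inv, norm_norm]
    exact inv_mul_cancel₀ (hne n).ne'
  obtain ⟨v₀, φ, hφ, hw⟩ := exists_weakTendsto_subseq (fun n => (hv1 n).le)
  have hε0 : Tendsto (fun n => 1 / ((φ n : ℝ) + 1)) atTop (𝓝 0) :=
    tendsto_one_div_add_atTop_nhds_zero_nat.comp hφ.tendsto_atTop
  have ht0 : Tendsto (fun n => t (φ n)) atTop (𝓝 0) :=
    squeeze_zero (fun n => (hne _).le) (fun n => (hun _).trans (min_le_right _ _)) hε0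
  have hKt := hK _ _ hw
  have hlt := hw.clm l
  have huv : ∀ n, u n - ubar = t n • v n := fun n => by
    simp only [hv]; rw [smul_inv_smul₀ (hne n).ne']
  -- The expansion at `t n • v n` against the violated growth bound; `‖v n‖ = 1` reduces `α‖·‖²` to
  -- `α t²`.
  have hbasic : ∀ n, t n * l (v n) + 1 / 2 * (t n ^ 2 * (α + K (v n))) - c * t n ^ 3 ≤
      1 / ((n : ℝ) + 1) / 2 * t n ^ 2 := by
    intro n
    have h1 := hj (u n - ubar) ((hun n).trans (min_le_left _ _))
    rw [add_sub_cancel] at h1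
    have h2 := (abs_le.1 h1).1
    have h3 := hju n
    have h4 : l (u n - ubar) = t n * l (v n) := by rw [huv]; simp
    have h5 : K (u n - ubar) = t n ^ 2 * K (v n) := by rw [huv, hKsmul]
    rw [h4, h5] at h2
    change j (u n) < j ubar + 1 / ((n : ℝ) + 1) / 2 * t n ^ 2 at h3
    change -(c * t n ^ 3) ≤ j (u n) - j ubar -
      (t n * l (v n) + 1 / 2 * (α * t n ^ 2 + t n ^ 2 * K (v n))) at h2
    linarith
  have hlv : ∀ n, 0 ≤ l (v n) := fun n => by
    simp only [hv, map_smul, smul_eq_mul]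
    exact mul_nonneg (inv_nonneg.2 (hne n).le) (hl _ (huS n))
  -- Division of `hbasic` by `t` bounds the nonnegative `l (v n)` by `t` times a convergent factor.
  have hl0 : l v₀ = 0 := by
    refine tendsto_nhds_unique hlt (squeeze_zero (fun n => hlv _) (g := fun n =>
      t (φ n) * (1 / ((φ n : ℝ) + 1) / 2 + c * t (φ n) - 1 / 2 * (α + K (v (φ n))))) (fun n => ?_) ?_)
    · have := hbasic (φ n)
      have hp := hne (φ n)
      refine le_of_mul_le_mul_left (a := t (φ n)) ?_ hp
      linarith
    · have := ht0.mul (((hε0.div_const 2).add (ht0.const_mul c)).sub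
        ((hKt.const_add α).const_mul (1 / 2)))
      rwa [zero_mul] at this
  -- The first-order term is nonnegative and may be dropped; then divide by `t²`.
  have hle : α + K v₀ ≤ 0 := by
    have h1 : Tendsto (fun n => 1 / ((φ n : ℝ) + 1) + 2 * c * t (φ n)) atTop (𝓝 0) := by
      simpa using hε0.add (ht0.const_mul (2 * c))
    refine le_of_tendsto_of_tendsto' (hKt.const_add α) h1 fun n => ?_
    have := hbasic (φ n)
    have hp := hne (φ n)
    have h2 := mul_nonneg hp.le (hlv (φ n))
    refine le_of_mul_le_mul_left (a := t (φ n) ^ 2) ?_ (by positivity)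
    linarith
  have hn : ‖v₀‖ ≤ 1 := hw.norm_le (fun n => (hv1 _).le)
  have hmem : v₀ ∈ C := hC (fun n => u (φ n)) (fun n => (t (φ n))⁻¹) v₀ (fun n => huS _)
    (fun n => inv_pos.2 (hne _)) hw hl0
  -- Since `‖v₀‖ ≤ 1`, `hle` gives `α‖v₀‖² + K v₀ ≤ 0`, which only the zero critical direction
  -- permits.
  have hv0 : v₀ = 0 := by
    by_contra h0
    have h1 := hpos v₀ hmem h0
    have h2 : α * ‖v₀‖ ^ 2 ≤ α * 1 :=
      mul_le_mul_of_nonneg_left (pow_le_one₀ (norm_nonneg _) hn) hα.le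
    linarith
  have hK0 : K 0 = 0 := by simpa using hKsmul 0 0
  rw [hv0, hK0] at hle
  linarith

end WeakConvergence

/-! ### Identifying second derivatives from expansions -/

/-- If a `C²` function has a second-order expansion with cubic remainder, then the quadratic part
of the expansion is given by the second derivative. -/
theorem fderiv_fderiv_apply_eq_of_expansion {X : Type*} [NormedAddCommGroup X] [NormedSpace ℝ X]
    {g : X → ℝ} (hg : ContDiffAt ℝ 2 g 0) {l : X →L[ℝ] ℝ} {q : X → ℝ} {r c : ℝ} (hr : 0 < r)
    (hq : ∀ (t : ℝ) (v : X), q (t • v) = t ^ 2 * q v)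
    (hexp : ∀ h : X, ‖h‖ ≤ r → |g h - g 0 - (l h + 1 / 2 * q h)| ≤ c * ‖h‖ ^ 3) (v : X) :
    fderiv ℝ (fderiv ℝ g) 0 v v = q v := by
  have hd : ∀ᶠ x in 𝓝 (0 : X), DifferentiableAt ℝ g x :=
    (hg.eventually (by simp)).mono fun x hx => hx.differentiableAt (by simp)
  have hd2 : DifferentiableAt ℝ (fderiv ℝ g) 0 :=
    (hg.fderiv_right (m := 1) (by norm_num)).differentiableAt (by simp)
  obtain ⟨ρ, hρ, hball⟩ : ∃ ρ > 0, ∀ t : ℝ, |t| < ρ → DifferentiableAt ℝ g (t • v) := by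
    have hc : Tendsto (fun t : ℝ => t • v) (𝓝 0) (𝓝 0) := by
      have : Continuous fun t : ℝ => t • v := by fun_prop
      simpa using this.tendsto 0
    obtain ⟨ρ, hρ, h⟩ := Metric.eventually_nhds_iff.1 (hc.eventually hd)
    exact ⟨ρ, hρ, fun t ht => h (by simpa using ht)⟩
  set D := fderiv ℝ (fderiv ℝ g) 0 v v with hD
  set A := fderiv ℝ g 0 v with hA
  have hline : ∀ t : ℝ, HasDerivAt (fun t : ℝ => t • v) v t := fun t => by
    simpa using (hasDerivAt_id t).smul_const v
  have hG : ∀ t : ℝ, |t| < ρ → HasDerivAt (fun t : ℝ => g (t • v)) (fderiv ℝ g (t • v) v) t :=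
    fun t ht => (hball t ht).hasFDerivAt.comp_hasDerivAt t (hline t)
  have hG' : HasDerivAt (fun t : ℝ => fderiv ℝ g (t • v) v) D 0 := by
    have h1 : HasFDerivAt (fderiv ℝ g) (fderiv ℝ (fderiv ℝ g) 0) ((0 : ℝ) • v) := by
      rw [zero_smul]; exact hd2.hasFDerivAt
    have h2 := h1.comp_hasDerivAt (0 : ℝ) (hline 0)
    exact (ContinuousLinearMap.apply ℝ ℝ v).hasFDerivAt.comp_hasDerivAt (0 : ℝ) h2
  -- Taylor's formula with Peano remainder on the line `ℝ v`, by integrating the first-order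
  -- expansion of the derivative.
  have hlit : (fun t : ℝ => g (t • v) - A * t - D / 2 * t ^ 2 - g 0) =o[𝓝 0]
      fun t : ℝ => t ^ 2 := by
    have h0 : (0 : ℝ) ∈ Metric.ball (0 : ℝ) ρ := by simpa using hρ
    have key := Convex.isLittleO_pow_succ_real (f := fun t : ℝ => g (t • v) - A * t - D / 2 * t ^ 2)
      (f' := fun t => fderiv ℝ g (t • v) v - A - D * t) (n := 1) (convex_ball (0 : ℝ) ρ) h0
      (fun t ht => ?_) ?_
    · rw [nhdsWithin_eq_nhds.2 (Metric.ball_mem_nhds _ hρ)] at key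
      simpa using key
    · have h1 := ((hG t (by simpa using ht)).sub ((hasDerivAt_id t).const_mul A)).sub
        ((hasDerivAt_pow 2 t).const_mul (D / 2))
      refine (h1.congr_deriv ?_).hasDerivWithinAt
      simp
      ring
    · rw [nhdsWithin_eq_nhds.2 (Metric.ball_mem_nhds _ hρ)]
      have := hG'.isLittleO
      simpa [hA, mul_comm] using this
  have hcub : (fun t : ℝ => g (t • v) - g 0 - (l v * t + 1 / 2 * q v * t ^ 2)) =o[𝓝 0]
      fun t : ℝ => t ^ 2 := by
    have h3 : (fun t : ℝ => t ^ 3) =o[𝓝 0] fun t : ℝ => t ^ 2 :=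
      Asymptotics.isLittleO_pow_pow (by norm_num)
    refine Asymptotics.IsBigO.trans_isLittleO (Asymptotics.IsBigO.of_bound (c * ‖v‖ ^ 3) ?_) h3
    have hsmall : ∀ᶠ t : ℝ in 𝓝 0, ‖t • v‖ ≤ r := by
      have hc : Continuous fun t : ℝ => ‖t • v‖ := by fun_prop
      have := hc.tendsto 0
      simp only [zero_smul, norm_zero] at this
      exact this.eventually (eventually_le_nhds hr)
    filter_upwards [hsmall] with t ht
    have := hexp _ ht
    rw [hq, map_smul, smul_eq_mul, norm_smul, mul_pow] at this
    rw [Real.norm_eq_abs, Real.norm_eq_abs, abs_pow]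
    rw [Real.norm_eq_abs] at this
    calc _ = |g (t • v) - g 0 - (t * l v + 1 / 2 * (t ^ 2 * q v))| := by congr 1; ring
      _ ≤ _ := this
      _ = _ := by ring
  -- The two expansions differ by a quadratic polynomial that is `o(t²)`, so both its coefficients
  -- vanish.
  have hpoly : (fun t : ℝ => (l v - A) * t + (q v - D) / 2 * t ^ 2) =o[𝓝 0]
      fun t : ℝ => t ^ 2 := by
    refine (hlit.sub hcub).congr_left fun t => ?_
    ring
  have hlA : l v - A = 0 := by
    have h21 : (fun t : ℝ => t ^ 2) =o[𝓝 0] fun t : ℝ => t ^ 1 :=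
      Asymptotics.isLittleO_pow_pow (by norm_num)
    have h1 : (fun t : ℝ => (l v - A) * t) =o[𝓝 0] fun t : ℝ => t ^ 1 :=
      ((hpoly.trans h21).sub (h21.const_mul_left ((q v - D) / 2))).congr_left fun t => by ring
    by_contra hne
    have h2 : (fun t : ℝ => t) =o[𝓝 0] fun t : ℝ => t := by
      simpa using (Asymptotics.isLittleO_const_mul_left_iff hne).1 h1
    have h3 := (Asymptotics.isLittleO_irrefl (f'' := fun t : ℝ => t) (l := 𝓝[≠] (0 : ℝ)))
    exact h3 (Eventually.frequently (eventually_mem_nhdsWithin)) (h2.mono nhdsWithin_le_nhds)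
  have hqD : q v - D = 0 := by
    by_contra hne
    have h2 : (fun t : ℝ => t ^ 2) =o[𝓝 0] fun t : ℝ => t ^ 2 := by
      refine (Asymptotics.isLittleO_const_mul_left_iff (c := (q v - D) / 2) (by simpa using hne)).1 ?_
      simpa [hlA] using hpoly
    have h3 := (Asymptotics.isLittleO_irrefl (f'' := fun t : ℝ => t ^ 2) (l := 𝓝[≠] (0 : ℝ)))
    refine h3 (Eventually.frequently ?_) (h2.mono nhdsWithin_le_nhds)
    filter_upwards [eventually_mem_nhdsWithin] with t ht
    exact pow_ne_zero 2 ht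
  linarith

noncomputable section

/-! ### Bilinear control problems in Hilbert spaces -/

section AbstractControl

variable {V L W : Type*} [NormedAddCommGroup V] [InnerProductSpace ℝ V] [CompleteSpace V]
  [NormedAddCommGroup L] [InnerProductSpace ℝ L] [NormedAddCommGroup W] [InnerProductSpace ℝ W]

/-- The trilinear form `(h, y, φ) ↦ ⟪h, P y φ⟫`, as a map into forms on `V`. -/
def pairingForm (P : V →L[ℝ] V →L[ℝ] L) : L →L[ℝ] V →L[ℝ] V →L[ℝ] ℝ :=
  ((ContinuousLinearMap.compL ℝ V (V →L[ℝ] L) (V →L[ℝ] ℝ)).flip P) ∘L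
    ((ContinuousLinearMap.compL ℝ V L ℝ) ∘L (innerSL ℝ))

@[simp]
theorem pairingForm_apply (P : V →L[ℝ] V →L[ℝ] L) (h : L) (y φ : V) :
    pairingForm P h y φ = ⟪h, P y φ⟫ := rfl

/-- The solution of `A y + ⟪h, P y ·⟫ = F`. -/
def perturbedState (A : V ≃L[ℝ] (V →L[ℝ] ℝ)) (P : V →L[ℝ] V →L[ℝ] L) (F : V →L[ℝ] ℝ) (h : L) : V :=
  -- `inverse` is zero at non-invertible operators, so the equation is guaranteed only together with
  -- invertibility.
  ((A : V →L[ℝ] V →L[ℝ] ℝ) + pairingForm P h).inverse F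

/-- The cost of the control `ubar + h`, where `A` is the operator at `ubar`. -/
def perturbedCost (A : V ≃L[ℝ] (V →L[ℝ] ℝ)) (P : V →L[ℝ] V →L[ℝ] L) (F : V →L[ℝ] ℝ)
    (ι : V →L[ℝ] W) (w : W) (α : ℝ) (ubar : L) (h : L) : ℝ :=
  1 / 2 * ‖ι (perturbedState A P F h) - w‖ ^ 2 + α / 2 * ‖ubar + h‖ ^ 2

/-- The derivative of the state in direction `h`. -/
def linearizedState (A : V ≃L[ℝ] (V →L[ℝ] ℝ)) (P : V →L[ℝ] V →L[ℝ] L) (ybar : V) : L →L[ℝ] V :=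
  -((A.symm : (V →L[ℝ] ℝ) →L[ℝ] V) ∘L ((pairingForm P).flip ybar))

/-- The part of the second derivative of the cost other than `α‖h‖²`. -/
def curvatureForm (A : V ≃L[ℝ] (V →L[ℝ] ℝ)) (P : V →L[ℝ] V →L[ℝ] L) (ι : V →L[ℝ] W)
    (ybar zbar : V) (h : L) : ℝ :=
  ‖ι (linearizedState A P ybar h)‖ ^ 2 - 2 * ⟪h, P (linearizedState A P ybar h) zbar⟫

/-- The first derivative of the cost. -/
def costGradient (P : V →L[ℝ] V →L[ℝ] L) (α : ℝ) (ubar : L) (ybar zbar : V) : L →L[ℝ] ℝ :=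
  innerSL ℝ (α • ubar - P ybar zbar)

variable (A : V ≃L[ℝ] (V →L[ℝ] ℝ)) (P : V →L[ℝ] V →L[ℝ] L) (F : V →L[ℝ] ℝ)
  (ι : V →L[ℝ] W) (w : W) (α : ℝ) (ubar : L)

/-- Inversion of operators is smooth at an isomorphism, and `h` enters the operator affinely. -/
theorem contDiffAt_perturbedState {n : WithTop ℕ∞} : ContDiffAt ℝ n (perturbedState A P F) 0 := by
  have h1 : ContDiffAt ℝ n (fun h : L => (A : V →L[ℝ] V →L[ℝ] ℝ) + pairingForm P h) 0 :=
    contDiffAt_const.add (pairingForm P).contDiff.contDiffAt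
  have h2 : ContDiffAt ℝ n (ContinuousLinearMap.inverse : (V →L[ℝ] V →L[ℝ] ℝ) → _)
      ((A : V →L[ℝ] V →L[ℝ] ℝ) + pairingForm P 0) := by
    rw [map_zero, add_zero]
    exact contDiffAt_map_inverse A
  exact (h2.comp (0 : L) h1).clm_apply contDiffAt_const

theorem contDiffAt_perturbedCost {n : WithTop ℕ∞} :
    ContDiffAt ℝ n (perturbedCost A P F ι w α ubar) 0 := by
  have h1 : ContDiffAt ℝ n (fun h => ι (perturbedState A P F h) - w) 0 :=
    (ι.contDiff.contDiffAt.comp (0 : L) (contDiffAt_perturbedState A P F)).sub contDiffAt_const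
  have h2 : ContDiffAt ℝ n (fun h : L => ubar + h) 0 := contDiffAt_const.add contDiffAt_id
  exact (contDiffAt_const.mul (h1.norm_sq ℝ)).add (contDiffAt_const.mul (h2.norm_sq ℝ))

/-- Isomorphisms form an open set. The radius refers to the norm of `L`, with no sign or sup-norm
condition on `h`. -/
theorem exists_isInvertible_add_pairingForm :
    ∃ r > 0, ∀ h : L, ‖h‖ ≤ r → ((A : V →L[ℝ] V →L[ℝ] ℝ) + pairingForm P h).IsInvertible := by
  have h1 : Tendsto (fun h : L => (A : V →L[ℝ] V →L[ℝ] ℝ) + pairingForm P h) (𝓝 0)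
      (𝓝 (A : V →L[ℝ] V →L[ℝ] ℝ)) := by
    have : Continuous fun h : L => (A : V →L[ℝ] V →L[ℝ] ℝ) + pairingForm P h := by fun_prop
    simpa using this.tendsto 0
  have h2 := h1.eventually (ContinuousLinearEquiv.nhds A)
  obtain ⟨r, hr, h⟩ := Metric.eventually_nhds_iff.1 h2
  refine ⟨r / 2, by positivity, fun x hx => ?_⟩
  have := h (y := x) (by rw [dist_zero_right]; linarith)
  exact this

theorem perturbedState_spec {h : L}
    (hh : ((A : V →L[ℝ] V →L[ℝ] ℝ) + pairingForm P h).IsInvertible) :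
    A (perturbedState A P F h) + pairingForm P h (perturbedState A P F h) = F := by
  obtain ⟨e, he⟩ := hh
  rw [perturbedState, ← he, ContinuousLinearMap.inverse_equiv]
  have : e (e.symm F) = F := by simp
  have h2 := congrArg (fun T : V →L[ℝ] V →L[ℝ] ℝ => T (e.symm F)) he
  simp only [add_apply] at h2
  exact h2.symm.trans this

theorem perturbedState_unique {h : L}
    (hh : ((A : V →L[ℝ] V →L[ℝ] ℝ) + pairingForm P h).IsInvertible) {y : V}
    (hy : A y + pairingForm P h y = F) : y = perturbedState A P F h := by
  obtain ⟨e, he⟩ := hh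
  rw [perturbedState, ← he, ContinuousLinearMap.inverse_equiv]
  have h2 := congrArg (fun T : V →L[ℝ] V →L[ℝ] ℝ => T y) he
  simp only [add_apply] at h2
  have h3 : e y = F := h2.trans hy
  rw [← h3]; simp

theorem perturbedState_zero : perturbedState A P F 0 = A.symm F := by
  simp [perturbedState]

theorem apply_linearizedState (ybar : V) (h : L) :
    A (linearizedState A P ybar h) = -pairingForm P h ybar := by
  simp [linearizedState]

/-- Second-order expansion of the cost with cubic remainder. -/
theorem exists_perturbedCost_expansion {ybar zbar : V} (hy : A ybar = F)
    (hz : ∀ φ : V, A φ zbar = ⟪ι ybar - w, ι φ⟫) :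
    ∃ r > 0, ∃ c, ∀ h : L, ‖h‖ ≤ r →
      |perturbedCost A P F ι w α ubar h - perturbedCost A P F ι w α ubar 0 -
        (costGradient P α ubar ybar zbar h +
          1 / 2 * (α * ‖h‖ ^ 2 + curvatureForm A P ι ybar zbar h))| ≤ c * ‖h‖ ^ 3 := by
  obtain ⟨r₁, hr₁, hinv⟩ := exists_isInvertible_add_pairingForm A P
  have hy0 : perturbedState A P F 0 = ybar := by rw [perturbedState_zero, ← hy]; simp
  obtain ⟨r₂, hr₂, hbd⟩ : ∃ r₂ > 0, ∀ h : L, ‖h‖ ≤ r₂ →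
      ‖perturbedState A P F h‖ ≤ ‖ybar‖ + 1 := by
    have hc : ContinuousAt (fun h => ‖perturbedState A P F h‖) 0 :=
      (contDiffAt_perturbedState (n := 0) A P F).continuousAt.norm
    have := hc.eventually (p := fun x => x ≤ ‖ybar‖ + 1)
      (by simp only [hy0]; exact eventually_le_nhds (by linarith))
    obtain ⟨r, hr, h⟩ := Metric.eventually_nhds_iff.1 this
    exact ⟨r / 2, by positivity, fun x hx => h (y := x) (by rw [dist_zero_right]; linarith)⟩
  set a := ‖(A.symm : (V →L[ℝ] ℝ) →L[ℝ] V)‖ with ha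
  set p := ‖pairingForm P‖ with hp
  have ha0 : 0 ≤ a := norm_nonneg _
  have hp0 : 0 ≤ p := norm_nonneg _
  -- Each solution of such an equation gains a factor `‖h‖` over its datum `y`: thus `δ` and `η` are
  -- of order `‖h‖`, and `δ - η`, whose datum is `δ`, is of order `‖h‖²`.
  have hAsymm : ∀ (h : L) (x y : V), A x = -pairingForm P h y → ‖x‖ ≤ a * p * ‖h‖ * ‖y‖ := by
    intro h x y hx
    have h1 : x = (A.symm : (V →L[ℝ] ℝ) →L[ℝ] V) (-pairingForm P h y) := by
      rw [← hx]; simp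
    rw [h1]
    refine (ContinuousLinearMap.le_opNorm _ _).trans ?_
    rw [norm_neg]
    calc a * ‖pairingForm P h y‖ ≤ a * (p * ‖h‖ * ‖y‖) :=
          mul_le_mul_of_nonneg_left ((pairingForm P).le_opNorm₂ h y) ha0
      _ = _ := by ring
  set m := ‖ybar‖ + 1 with hm
  have hm0 : 0 ≤ m := by positivity
  set i := ‖ι‖ with hi
  have hi0 : 0 ≤ i := norm_nonneg _
  -- The first summand of the constant bounds the remainder of the tracking term (`b1`), the second
  -- that of the pairing with `zbar` (`b2`).
  refine ⟨min r₁ r₂, lt_min hr₁ hr₂,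
    i * i * (a * p) ^ 3 * m * m + p * (a * p) ^ 2 * m * ‖zbar‖, fun h hh => ?_⟩
  have hspec := perturbedState_spec A P F (hinv h (hh.trans (min_le_left _ _)))
  have hy1 := hbd h (hh.trans (min_le_right _ _))
  unfold perturbedCost curvatureForm
  rw [hy0, add_zero]
  set y := perturbedState A P F h with hyd
  set η := linearizedState A P ybar h with hη
  have hAη : A η = -pairingForm P h ybar := apply_linearizedState A P ybar h
  set δ := y - ybar with hδ
  have hyδ : y = ybar + δ := by simp [hδ]
  have hAδ : A δ = -pairingForm P h y := by
    rw [hδ, map_sub, hy, ← hspec]; abel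
  have hAρ : A (δ - η) = -pairingForm P h δ := by
    rw [map_sub, hAδ, hAη, hδ, map_sub]; abel
  have nδ : ‖δ‖ ≤ a * p * ‖h‖ * m :=
    (hAsymm h δ y hAδ).trans (mul_le_mul_of_nonneg_left hy1 (by positivity))
  have nη : ‖η‖ ≤ a * p * ‖h‖ * m :=
    (hAsymm h η ybar hAη).trans (mul_le_mul_of_nonneg_left (by linarith) (by positivity))
  have nρ : ‖δ - η‖ ≤ (a * p * ‖h‖) ^ 2 * m :=
    (hAsymm h _ δ hAρ).trans (by
      calc _ ≤ a * p * ‖h‖ * (a * p * ‖h‖ * m) :=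
            mul_le_mul_of_nonneg_left nδ (by positivity)
        _ = _ := by ring)
  have e1 : ‖ι y - w‖ ^ 2 = ‖ι ybar - w‖ ^ 2 + 2 * ⟪ι ybar - w, ι δ⟫ + ‖ι δ‖ ^ 2 := by
    rw [hyδ, map_add, ← norm_add_sq_real]
    congr 2; abel
  have e2 : ‖ubar + h‖ ^ 2 = ‖ubar‖ ^ 2 + 2 * ⟪ubar, h⟫ + ‖h‖ ^ 2 := norm_add_sq_real _ _
  -- The adjoint equation turns the linear tracking term into pairings with `h`: one is part of the
  -- gradient, the other is of second order.
  have e3 : ⟪ι ybar - w, ι δ⟫ = -⟪h, P ybar zbar⟫ - ⟪h, P δ zbar⟫ := by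
    rw [← hz, hAδ, hyδ]
    simp
    ring
  have e4 : costGradient P α ubar ybar zbar h = α * ⟪ubar, h⟫ - ⟪h, P ybar zbar⟫ := by
    simp [costGradient, real_inner_comm]
  have e5 : ⟪h, P (δ - η) zbar⟫ = ⟪h, P δ zbar⟫ - ⟪h, P η zbar⟫ := by
    simp [inner_sub_right]
  have e6 : ‖ι δ‖ ^ 2 - ‖ι η‖ ^ 2 = ⟪ι (δ - η), ι (δ + η)⟫ := by
    rw [map_sub ι δ η, map_add ι δ η, inner_sub_left, inner_add_right, inner_add_right,
      real_inner_self_eq_norm_sq, real_inner_self_eq_norm_sq, real_inner_comm (ι δ) (ι η)]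
    ring
  -- Everything up to second order cancels; each remaining term pairs `δ - η` with a factor of order
  -- `‖h‖`.
  have hrem : 1 / 2 * ‖ι y - w‖ ^ 2 + α / 2 * ‖ubar + h‖ ^ 2 -
        (1 / 2 * ‖ι ybar - w‖ ^ 2 + α / 2 * ‖ubar‖ ^ 2) -
        (costGradient P α ubar ybar zbar h +
          1 / 2 * (α * ‖h‖ ^ 2 + (‖ι η‖ ^ 2 - 2 * ⟪h, P η zbar⟫))) =
      1 / 2 * ⟪ι (δ - η), ι (δ + η)⟫ - ⟪h, P (δ - η) zbar⟫ := by
    rw [e1, e2, e3, e4, e5, ← e6]; ring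
  rw [hrem]
  have b1 : |⟪ι (δ - η), ι (δ + η)⟫| ≤ 2 * (i * i * (a * p) ^ 3 * m * m * ‖h‖ ^ 3) := by
    have n1 : ‖ι (δ - η)‖ ≤ i * ((a * p * ‖h‖) ^ 2 * m) :=
      (ι.le_opNorm _).trans (mul_le_mul_of_nonneg_left nρ hi0)
    have n2 : ‖ι (δ + η)‖ ≤ i * (a * p * ‖h‖ * m + a * p * ‖h‖ * m) :=
      (ι.le_opNorm _).trans (mul_le_mul_of_nonneg_left
        ((norm_add_le _ _).trans (add_le_add nδ nη)) hi0)
    refine (abs_real_inner_le_norm _ _).trans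
      ((mul_le_mul n1 n2 (norm_nonneg _) (by positivity)).trans (le_of_eq ?_))
    ring
  have b2 : |⟪h, P (δ - η) zbar⟫| ≤ p * (a * p) ^ 2 * m * ‖zbar‖ * ‖h‖ ^ 3 := by
    have n1 : |⟪h, P (δ - η) zbar⟫| ≤ p * ‖h‖ * ‖δ - η‖ * ‖zbar‖ := by
      rw [← pairingForm_apply, ← Real.norm_eq_abs]
      refine ((pairingForm P h (δ - η)).le_opNorm zbar).trans
        (mul_le_mul_of_nonneg_right ((pairingForm P).le_opNorm₂ h _) (norm_nonneg _))
    refine n1.trans ?_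
    calc p * ‖h‖ * ‖δ - η‖ * ‖zbar‖ ≤ p * ‖h‖ * ((a * p * ‖h‖) ^ 2 * m) * ‖zbar‖ := by gcongr
      _ = _ := by ring
  calc |1 / 2 * ⟪ι (δ - η), ι (δ + η)⟫ - ⟪h, P (δ - η) zbar⟫|
      ≤ |1 / 2 * ⟪ι (δ - η), ι (δ + η)⟫| + |⟪h, P (δ - η) zbar⟫| := abs_sub _ _
    _ = 1 / 2 * |⟪ι (δ - η), ι (δ + η)⟫| + |⟪h, P (δ - η) zbar⟫| := by
        rw [abs_mul, abs_of_nonneg (by norm_num : (0 : ℝ) ≤ 1 / 2)]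
    _ ≤ _ := by rw [add_mul]; linarith

theorem curvatureForm_smul (ybar zbar : V) (t : ℝ) (h : L) :
    curvatureForm A P ι ybar zbar (t • h) = t ^ 2 * curvatureForm A P ι ybar zbar h := by
  simp only [curvatureForm, map_smul, norm_smul, mul_pow, Real.norm_eq_abs, sq_abs,
    smul_apply, inner_smul_left, inner_smul_right]
  simp
  ring

theorem continuous_curvatureForm (ybar zbar : V) :
    Continuous (curvatureForm A P ι ybar zbar) := by
  unfold curvatureForm
  have : Continuous fun h : L => P (linearizedState A P ybar h) zbar := by fun_prop
  fun_prop

/-- The curvature form is weakly sequentially continuous if `ι` and `P · zbar` map weakly null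
sequences to null sequences. -/
theorem WeakTendsto.curvatureForm [CompleteSpace L] {ybar zbar : V}
    (hι : ∀ x : ℕ → V, WeakTendsto x 0 → Tendsto (fun n => ι (x n)) atTop (𝓝 0))
    (hP : ∀ x : ℕ → V, WeakTendsto x 0 → Tendsto (fun n => P (x n) zbar) atTop (𝓝 0))
    {h : ℕ → L} {h₀ : L} (hh : WeakTendsto h h₀) :
    Tendsto (fun n => curvatureForm A P ι ybar zbar (h n)) atTop
      (𝓝 (curvatureForm A P ι ybar zbar h₀)) := by
  set T := linearizedState A P ybar with hT
  have hη : WeakTendsto (fun n => T (h n) - T h₀) 0 := (hh.map T).sub_const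
  have h1 : Tendsto (fun n => ι (T (h n))) atTop (𝓝 (ι (T h₀))) := by
    rw [← tendsto_sub_nhds_zero_iff]
    simpa using hι _ hη
  have h2 : Tendsto (fun n => P (T (h n)) zbar - P (T h₀) zbar) atTop (𝓝 0) := by
    simpa using hP _ hη
  obtain ⟨M, hM⟩ := hh.isBounded
  have h3 : Tendsto (fun n => ⟪h n, P (T (h n)) zbar - P (T h₀) zbar⟫) atTop (𝓝 0) := by
    refine squeeze_zero_norm (fun n => (norm_inner_le_norm _ _).trans
      (mul_le_mul_of_nonneg_right (hM n) (norm_nonneg _))) ?_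
    simpa using h2.norm.const_mul M
  have h4 : Tendsto (fun n => ⟪h n, P (T h₀) zbar⟫) atTop (𝓝 ⟪h₀, P (T h₀) zbar⟫) := by
    simpa [real_inner_comm] using hh (P (T h₀) zbar)
  have h5 : Tendsto (fun n => ⟪h n, P (T (h n)) zbar⟫) atTop (𝓝 ⟪h₀, P (T h₀) zbar⟫) := by
    have := h3.add h4
    simp only [← inner_add_right, sub_add_cancel, zero_add] at this
    exact this
  exact (h1.norm.pow 2).sub (h5.const_mul 2)

/-- The second derivative of the cost, in a space of controls continuously mapped into `L`. -/
theorem fderiv_fderiv_eq_of_eq_perturbedCost {X : Type*} [NormedAddCommGroup X] [NormedSpace ℝ X]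
    (J : X →L[ℝ] L) {g : X → ℝ} {r : ℝ} (hr : 0 < r)
    (hg : ∀ x : X, ‖J x‖ ≤ r → g x = perturbedCost A P F ι w α ubar (J x)) {ybar zbar : V}
    (hy : A ybar = F) (hz : ∀ φ : V, A φ zbar = ⟪ι ybar - w, ι φ⟫) (v : X) :
    fderiv ℝ (fderiv ℝ g) 0 v v = α * ‖J v‖ ^ 2 + curvatureForm A P ι ybar zbar (J v) := by
  obtain ⟨r', hr', c, hexp⟩ := exists_perturbedCost_expansion A P F ι w α ubar hy hz
  have hJ0 : 0 ≤ ‖J‖ := norm_nonneg _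
  -- The `+ 1` keeps the denominator positive when `J = 0`.
  have hJsmall : ∀ {ρ : ℝ}, 0 < ρ → ∀ h : X, ‖h‖ ≤ ρ / (‖J‖ + 1) → ‖J h‖ ≤ ρ := by
    intro ρ hρ h hh
    have h1 := (le_div_iff₀ (by positivity)).1 hh
    refine (J.le_opNorm h).trans ?_
    linarith [norm_nonneg h]
  have hgC : ContDiffAt ℝ 2 g 0 := by
    have h0 : ContDiffAt ℝ 2 (perturbedCost A P F ι w α ubar) (J 0) := by
      rw [map_zero]
      exact contDiffAt_perturbedCost A P F ι w α ubar
    have h1 := h0.comp (0 : X) J.contDiff.contDiffAt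
    refine h1.congr_of_eventuallyEq ?_
    have hρ : 0 < r / (‖J‖ + 1) := by positivity
    filter_upwards [Metric.closedBall_mem_nhds (0 : X) hρ] with h hh
    exact hg h (hJsmall hr h (by simpa using hh))
  have hmin : 0 < min r' r / (‖J‖ + 1) := by
    have := lt_min hr' hr
    positivity
  refine fderiv_fderiv_apply_eq_of_expansion hgC
    (l := costGradient P α ubar ybar zbar ∘L J)
    (q := fun h => α * ‖J h‖ ^ 2 + curvatureForm A P ι ybar zbar (J h))
    -- `|c|`, because the sign of `c` is not known.
    (c := |c| * ‖J‖ ^ 3) hmin (fun t v => ?_) (fun h hh => ?_) v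
  · simp only [map_smul, curvatureForm_smul, norm_smul, mul_pow, Real.norm_eq_abs, sq_abs]
    ring
  · have h1 := hJsmall (lt_min hr' hr) h hh
    have h2 := hexp (J h) (h1.trans (min_le_left _ _))
    rw [hg h (h1.trans (min_le_right _ _)), hg 0 (by simpa using hr.le), map_zero]
    refine h2.trans ?_
    calc c * ‖J h‖ ^ 3 ≤ |c| * (‖J‖ * ‖h‖) ^ 3 :=
          mul_le_mul (le_abs_self c) (pow_le_pow_left₀ (norm_nonneg _) (J.le_opNorm h) 3)
            (by positivity) (abs_nonneg c)
      _ = _ := by ring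

/-- Second-order sufficient conditions for the bilinear control problem. -/
theorem quadratic_growth_of_eq_perturbedCost [CompleteSpace L]
    [TopologicalSpace.SeparableSpace L] {S C : Set L} {j : L → ℝ} {r : ℝ} (hr : 0 < r)
    (hj : ∀ h : L, ‖h‖ ≤ r → j (ubar + h) = perturbedCost A P F ι w α ubar h) (hα : 0 < α)
    {ybar zbar : V} (hy : A ybar = F) (hz : ∀ φ : V, A φ zbar = ⟪ι ybar - w, ι φ⟫)
    (hι : ∀ x : ℕ → V, WeakTendsto x 0 → Tendsto (fun n => ι (x n)) atTop (𝓝 0))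
    (hP : ∀ x : ℕ → V, WeakTendsto x 0 → Tendsto (fun n => P (x n) zbar) atTop (𝓝 0))
    (hl : ∀ u ∈ S, 0 ≤ ⟪α • ubar - P ybar zbar, u - ubar⟫)
    (hC : ∀ (u : ℕ → L) (t : ℕ → ℝ) (v : L), (∀ n, u n ∈ S) → (∀ n, 0 < t n) →
      WeakTendsto (fun n => t n • (u n - ubar)) v → ⟪α • ubar - P ybar zbar, v⟫ = 0 → v ∈ C)
    (hpos : ∀ v ∈ C, v ≠ 0 → 0 < α * ‖v‖ ^ 2 + curvatureForm A P ι ybar zbar v) :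
    ∃ δ > 0, ∃ σ > 0, ∀ u ∈ S, ‖u - ubar‖ ≤ δ → j u ≥ j ubar + σ / 2 * ‖u - ubar‖ ^ 2 := by
  obtain ⟨r', hr', c, hexp⟩ := exists_perturbedCost_expansion A P F ι w α ubar hy hz
  refine quadratic_growth (l := costGradient P α ubar ybar zbar) (c := c) hα (lt_min hr hr')
    (curvatureForm_smul A P ι ybar zbar) (fun x v hxv => WeakTendsto.curvatureForm A P ι hι hP hxv)
    (fun h hh => ?_) hl hC hpos
  have h0 := hj 0 (by simpa using hr.le)
  rw [add_zero] at h0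
  rw [hj h (hh.trans (min_le_left _ _)), h0]
  exact hexp h (hh.trans (min_le_right _ _))

end AbstractControl

end

noncomputable section

/-! ### Compactness: averages of functions with square integrable gradient -/

section Averages

/-- Jensen's inequality for the square. -/
theorem sq_lintegral_le_lintegral_sq {X : Type*} [MeasurableSpace X] {μ : Measure X}
    [IsProbabilityMeasure μ] {f : X → ℝ≥0∞} (hf : AEMeasurable f μ) :
    (∫⁻ x, f x ∂μ) ^ 2 ≤ ∫⁻ x, f x ^ 2 ∂μ := by
  have h := ENNReal.lintegral_mul_le_Lp_mul_Lq μ Real.HolderConjugate.two_two hf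
    (aemeasurable_const (b := (1 : ℝ≥0∞)))
  simp only [Pi.mul_apply, mul_one, ENNReal.one_rpow, lintegral_one, measure_univ] at h
  calc (∫⁻ x, f x ∂μ) ^ 2 ≤ ((∫⁻ x, f x ^ (2 : ℝ) ∂μ) ^ (1 / 2 : ℝ)) ^ 2 := by gcongr
    _ = ∫⁻ x, f x ^ 2 ∂μ := by
      rw [← ENNReal.rpow_natCast, ← ENNReal.rpow_mul]
      norm_num

variable {E F : Type*} [NormedAddCommGroup E] [NormedSpace ℝ E] [FiniteDimensional ℝ E]
  [MeasurableSpace E] [BorelSpace E] [NormedAddCommGroup F] [NormedSpace ℝ F]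
  [CompleteSpace F] {μ : Measure E} [μ.IsAddHaarMeasure]

/-- A translation moves a function in `L²` by at most the length of the translation times the
`L²` norm of the derivative. -/
theorem lintegral_enorm_translate_sub_sq_le {φ : E → F} (hφ : ContDiff ℝ 1 φ) (h : E) :
    ∫⁻ x, ‖φ (x + h) - φ x‖ₑ ^ 2 ∂μ ≤ ‖h‖ₑ ^ 2 * ∫⁻ x, ‖fderiv ℝ φ x‖ₑ ^ 2 ∂μ := by
  have hc : Continuous (fderiv ℝ φ) := hφ.continuous_fderiv (by simp)
  set ν : Measure ℝ := volume.restrict (Set.Ioc (0 : ℝ) 1) with hν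
  have : IsProbabilityMeasure ν := ⟨by simp [hν]⟩
  have hmeas : Measurable fun z : E × ℝ => ‖fderiv ℝ φ (z.1 + z.2 • h)‖ₑ ^ 2 := by
    have : Continuous fun z : E × ℝ => fderiv ℝ φ (z.1 + z.2 • h) := by fun_prop
    exact (this.enorm.measurable).pow_const 2
  -- Fundamental theorem of calculus on the segment from `x` to `x + h`, then Jensen in `t`;
  -- afterwards Tonelli and translation invariance remove `t`.
  have hpt : ∀ x, ‖φ (x + h) - φ x‖ₑ ^ 2 ≤
      ‖h‖ₑ ^ 2 * ∫⁻ t, ‖fderiv ℝ φ (x + t • h)‖ₑ ^ 2 ∂ν := by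
    intro x
    have hder : ∀ t : ℝ, HasDerivAt (fun t : ℝ => φ (x + t • h)) (fderiv ℝ φ (x + t • h) h) t := by
      intro t
      have h1 : HasDerivAt (fun t : ℝ => x + t • h) h t := by
        simpa using ((hasDerivAt_id t).smul_const h).const_add x
      exact ((hφ.differentiable (by simp)) _).hasFDerivAt.comp_hasDerivAt t h1
    have hcl : Continuous fun t : ℝ => fderiv ℝ φ (x + t • h) := by fun_prop
    have hftc := intervalIntegral.integral_eq_sub_of_hasDerivAt (a := 0) (b := 1)
      (fun t _ => hder t) ((hcl.clm_apply continuous_const).intervalIntegrable _ _)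
    simp only [one_smul, zero_smul, add_zero] at hftc
    rw [← hftc, intervalIntegral.integral_of_le zero_le_one]
    calc ‖∫ t in Set.Ioc (0 : ℝ) 1, fderiv ℝ φ (x + t • h) h‖ₑ ^ 2
        ≤ (∫⁻ t, ‖fderiv ℝ φ (x + t • h) h‖ₑ ∂ν) ^ 2 := by
          gcongr; exact enorm_integral_le_lintegral_enorm _
      _ ≤ ∫⁻ t, ‖fderiv ℝ φ (x + t • h) h‖ₑ ^ 2 ∂ν :=
          sq_lintegral_le_lintegral_sq
            (hcl.clm_apply continuous_const).enorm.measurable.aemeasurable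
      _ ≤ ∫⁻ t, ‖h‖ₑ ^ 2 * ‖fderiv ℝ φ (x + t • h)‖ₑ ^ 2 ∂ν := by
          refine lintegral_mono fun t => ?_
          rw [← mul_pow, mul_comm]
          gcongr
          exact ContinuousLinearMap.le_opENorm _ _
      _ = _ := lintegral_const_mul' _ _ (by finiteness)
  calc ∫⁻ x, ‖φ (x + h) - φ x‖ₑ ^ 2 ∂μ
      ≤ ∫⁻ x, ‖h‖ₑ ^ 2 * ∫⁻ t, ‖fderiv ℝ φ (x + t • h)‖ₑ ^ 2 ∂ν ∂μ := lintegral_mono hpt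
    _ = ‖h‖ₑ ^ 2 * ∫⁻ x, ∫⁻ t, ‖fderiv ℝ φ (x + t • h)‖ₑ ^ 2 ∂ν ∂μ :=
        lintegral_const_mul' _ _ (by finiteness)
    _ = ‖h‖ₑ ^ 2 * ∫⁻ t, ∫⁻ x, ‖fderiv ℝ φ (x + t • h)‖ₑ ^ 2 ∂μ ∂ν := by
        rw [lintegral_lintegral_swap hmeas.aemeasurable]
    _ = ‖h‖ₑ ^ 2 * ∫⁻ x, ‖fderiv ℝ φ x‖ₑ ^ 2 ∂μ := by
        congr 1
        have : ∀ t : ℝ, ∫⁻ x, ‖fderiv ℝ φ (x + t • h)‖ₑ ^ 2 ∂μ = ∫⁻ x, ‖fderiv ℝ φ x‖ₑ ^ 2 ∂μ :=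
          fun t => lintegral_add_right_eq_self (fun x => ‖fderiv ℝ φ x‖ₑ ^ 2) (t • h)
        simp [this]

/-- The average of `φ` over the ball of radius `ε` about `x`. -/
def ballAverage (μ : Measure E) (ε : ℝ) (φ : E → F) (x : E) : F :=
  ∫ h, φ (x + h) ∂(ProbabilityTheory.cond μ (Metric.ball 0 ε))

theorem isProbabilityMeasure_cond_ball {ε : ℝ} (hε : 0 < ε) :
    IsProbabilityMeasure (ProbabilityTheory.cond μ (Metric.ball 0 ε)) :=
  ProbabilityTheory.cond_isProbabilityMeasure_of_finite
    (Metric.measure_ball_pos μ 0 hε).ne' measure_ball_lt_top.ne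

/-- The difference is an average of `φ x - φ (x + h)` over `‖h‖ < ε`, so Jensen reduces it to the
translation estimate. -/
theorem lintegral_enorm_sub_ballAverage_sq_le {φ : E → F} (hφ : ContDiff ℝ 1 φ)
    (hs : HasCompactSupport φ) {ε : ℝ} (hε : 0 < ε) :
    ∫⁻ x, ‖φ x - ballAverage μ ε φ x‖ₑ ^ 2 ∂μ ≤
      ENNReal.ofReal ε ^ 2 * ∫⁻ x, ‖fderiv ℝ φ x‖ₑ ^ 2 ∂μ := by
  set ν := ProbabilityTheory.cond μ (Metric.ball (0 : E) ε) with hν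
  have : IsProbabilityMeasure ν := isProbabilityMeasure_cond_ball hε
  have hint : ∀ x, Integrable (fun h => φ (x + h)) ν := fun x => by
    obtain ⟨C, hC⟩ := hφ.continuous.bounded_above_of_compact_support hs
    exact Integrable.of_bound (by
      exact (hφ.continuous.comp (continuous_const.add continuous_id)).aestronglyMeasurable) C
      (Eventually.of_forall fun h => hC _)
  have hmeas : Measurable fun z : E × E => ‖φ (z.1 + z.2) - φ z.1‖ₑ ^ 2 := by
    have hcφ := hφ.continuous
    have : Continuous fun z : E × E => φ (z.1 + z.2) - φ z.1 := by fun_prop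
    exact (this.enorm.measurable).pow_const 2
  have hpt : ∀ x, ‖φ x - ballAverage μ ε φ x‖ₑ ^ 2 ≤ ∫⁻ h, ‖φ (x + h) - φ x‖ₑ ^ 2 ∂ν := by
    intro x
    have h1 : φ x - ballAverage μ ε φ x = ∫ h, (φ x - φ (x + h)) ∂ν := by
      rw [integral_sub (integrable_const _) (hint x)]
      simp [ballAverage, hν]
    rw [h1]
    refine le_trans (pow_le_pow_left₀ zero_le (enorm_integral_le_lintegral_enorm _) 2) ?_
    simp only [enorm_sub_rev (φ x)]
    have hcφ := hφ.continuous
    have : Continuous fun h : E => φ (x + h) - φ x := by fun_prop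
    exact sq_lintegral_le_lintegral_sq this.enorm.measurable.aemeasurable
  calc ∫⁻ x, ‖φ x - ballAverage μ ε φ x‖ₑ ^ 2 ∂μ
      ≤ ∫⁻ x, ∫⁻ h, ‖φ (x + h) - φ x‖ₑ ^ 2 ∂ν ∂μ := lintegral_mono hpt
    _ = ∫⁻ h, ∫⁻ x, ‖φ (x + h) - φ x‖ₑ ^ 2 ∂μ ∂ν := lintegral_lintegral_swap hmeas.aemeasurable
    _ ≤ ∫⁻ h, ENNReal.ofReal ε ^ 2 * ∫⁻ x, ‖fderiv ℝ φ x‖ₑ ^ 2 ∂μ ∂ν := by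
        refine lintegral_mono_ae ?_
        filter_upwards [ProbabilityTheory.ae_cond_mem (μ := μ) measurableSet_ball] with h hh
        refine (lintegral_enorm_translate_sub_sq_le hφ h).trans ?_
        gcongr
        rw [← ofReal_norm]
        exact ENNReal.ofReal_le_ofReal (by simpa using (Metric.mem_ball.1 hh).le)
    _ = _ := by simp

/-- By Jensen; the bound is independent of `x` and so provides a constant dominating function. -/
theorem enorm_ballAverage_sq_le {φ : E → F} (hφ : Continuous φ) {ε : ℝ} (hε : 0 < ε) (x : E) :
    ‖ballAverage μ ε φ x‖ₑ ^ 2 ≤ (μ (Metric.ball 0 ε))⁻¹ * ∫⁻ y, ‖φ y‖ₑ ^ 2 ∂μ := by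
  have : IsProbabilityMeasure (ProbabilityTheory.cond μ (Metric.ball (0 : E) ε)) :=
    isProbabilityMeasure_cond_ball hε
  have hc : Continuous fun h : E => φ (x + h) := by fun_prop
  refine (pow_le_pow_left₀ zero_le (enorm_integral_le_lintegral_enorm _) 2).trans
    ((sq_lintegral_le_lintegral_sq hc.enorm.measurable.aemeasurable).trans ?_)
  rw [ProbabilityTheory.cond, lintegral_smul_measure, smul_eq_mul]
  refine mul_le_mul_right ((setLIntegral_le_lintegral _ _).trans (le_of_eq ?_)) _
  exact lintegral_add_left_eq_self (fun y => ‖φ y‖ₑ ^ 2) x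

theorem ballAverage_eq_setIntegral (φ : E → F) (ε : ℝ) (x : E) :
    ballAverage μ ε φ x = (μ (Metric.ball 0 ε))⁻¹.toReal • ∫ y in Metric.ball x ε, φ y ∂μ := by
  rw [ballAverage, ProbabilityTheory.cond, integral_smul_measure]
  congr 1
  rw [← integral_indicator measurableSet_ball, ← integral_indicator measurableSet_ball,
    ← integral_add_left_eq_self ((Metric.ball x ε).indicator φ) x]
  congr 1
  ext h
  simp [Set.indicator]

/-- A sequence of compactly supported functions which is bounded in `H¹` and whose integrals over
balls tend to zero converges to zero in `L²` of each set of finite measure. -/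
theorem tendsto_lintegral_enorm_sq_zero {Ω : Set E} (hΩ : μ Ω ≠ ⊤)
    {φ : ℕ → E → F} (hφ : ∀ n, ContDiff ℝ 1 (φ n)) (hs : ∀ n, HasCompactSupport (φ n)) {M : ℝ≥0∞} (hM : M ≠ ⊤)
    (h0 : ∀ n, ∫⁻ x, ‖φ n x‖ₑ ^ 2 ∂μ ≤ M) (h1 : ∀ n, ∫⁻ x, ‖fderiv ℝ (φ n) x‖ₑ ^ 2 ∂μ ≤ M)
    (hw : ∀ x ε, Tendsto (fun n => ∫ y in Metric.ball x ε, φ n y ∂μ) atTop (𝓝 0)) :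
    Tendsto (fun n => ∫⁻ x in Ω, ‖φ n x‖ₑ ^ 2 ∂μ) atTop (𝓝 0) := by
  have : IsFiniteMeasure (μ.restrict Ω) := ⟨by simpa using hΩ.lt_top⟩
  have hmeas : ∀ n ε, 0 < ε → Measurable (fun x => ‖ballAverage μ ε (φ n) x‖ₑ ^ 2) := by
    intro n ε hε
    have : IsProbabilityMeasure (ProbabilityTheory.cond μ (Metric.ball (0 : E) ε)) :=
      isProbabilityMeasure_cond_ball hε
    have hcφ := (hφ n).continuous
    have hc : Continuous fun z : E × E => φ n (z.1 + z.2) := by fun_prop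
    exact (hc.stronglyMeasurable.integral_prod_right'
      (ν := ProbabilityTheory.cond μ (Metric.ball (0 : E) ε))).enorm.pow_const 2
  -- At fixed `ε` the averages tend to zero pointwise by `hw`, and a constant dominates them on the
  -- finite-measure set `Ω`.
  have havg : ∀ ε, 0 < ε →
      Tendsto (fun n => ∫⁻ x in Ω, ‖ballAverage μ ε (φ n) x‖ₑ ^ 2 ∂μ) atTop (𝓝 0) := by
    intro ε hε
    have hb : (μ (Metric.ball (0 : E) ε))⁻¹ ≠ ⊤ :=
      ENNReal.inv_ne_top.2 (Metric.measure_ball_pos μ 0 hε).ne'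
    have := tendsto_lintegral_of_dominated_convergence (μ := μ.restrict Ω)
      (F := fun n x => ‖ballAverage μ ε (φ n) x‖ₑ ^ 2) (f := fun _ => 0)
      (fun _ => (μ (Metric.ball (0 : E) ε))⁻¹ * M) ?_ ?_ ?_ ?_
    · simpa using this
    · exact fun n => hmeas n ε hε
    · exact fun n => Eventually.of_forall fun x =>
        (enorm_ballAverage_sq_le (hφ n).continuous hε x).trans (mul_le_mul_right (h0 n) _)
    · simp only [lintegral_const]
      finiteness
    · refine Eventually.of_forall fun x => ?_
      have h2 : Tendsto (fun n => ballAverage μ ε (φ n) x) atTop (𝓝 0) := by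
        simp_rw [ballAverage_eq_setIntegral]
        simpa using (hw x ε).const_smul (μ (Metric.ball (0 : E) ε))⁻¹.toReal
      have h3 := ENNReal.Tendsto.pow (n := 2) h2.enorm
      simpa using h3
  rw [ENNReal.tendsto_nhds_zero]
  intro η hη
  -- This `ε` makes the distance of `φ n` from its average small uniformly in `n`; only then does
  -- `n` grow.
  obtain ⟨ε, hεη, hε⟩ : ∃ ε : ℝ, 2 * (ENNReal.ofReal ε ^ 2 * M) ≤ η / 2 ∧ 0 < ε := by
    have h2 : Tendsto (fun ε : ℝ => 2 * (ENNReal.ofReal ε ^ 2 * M)) (𝓝 0) (𝓝 0) := by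
      have h3 : Tendsto (fun ε : ℝ => ENNReal.ofReal ε) (𝓝 0) (𝓝 0) := by
        simpa using ENNReal.tendsto_ofReal (tendsto_id (α := ℝ) (x := 𝓝 0))
      have h4 := ENNReal.Tendsto.const_mul (a := 2) (ENNReal.Tendsto.mul_const
        (b := M) (ENNReal.Tendsto.pow (n := 2) h3) (Or.inr hM)) (Or.inr (by simp))
      simpa using h4
    have h3 : ∀ᶠ ε : ℝ in 𝓝[>] 0, 2 * (ENNReal.ofReal ε ^ 2 * M) ≤ η / 2 :=
      (h2.mono_left nhdsWithin_le_nhds).eventually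
        (eventually_le_nhds (ENNReal.half_pos hη.ne'))
    exact (h3.and self_mem_nhdsWithin).exists
  have h2 : Tendsto (fun n => 2 * ∫⁻ x in Ω, ‖ballAverage μ ε (φ n) x‖ₑ ^ 2 ∂μ) atTop (𝓝 0) := by
    simpa using ENNReal.Tendsto.const_mul (a := 2) (havg ε hε) (Or.inr (by simp))
  filter_upwards [h2.eventually (eventually_le_nhds (ENNReal.half_pos hη.ne'))] with n hn
  calc ∫⁻ x in Ω, ‖φ n x‖ₑ ^ 2 ∂μ
      ≤ ∫⁻ x in Ω, (2 * ‖φ n x - ballAverage μ ε (φ n) x‖ₑ ^ 2 +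
          2 * ‖ballAverage μ ε (φ n) x‖ₑ ^ 2) ∂μ := by
        refine lintegral_mono fun x => ?_
        calc ‖φ n x‖ₑ ^ 2
            = ‖(φ n x - ballAverage μ ε (φ n) x) + ballAverage μ ε (φ n) x‖ₑ ^ 2 := by
              rw [sub_add_cancel]
          _ ≤ (‖φ n x - ballAverage μ ε (φ n) x‖ₑ + ‖ballAverage μ ε (φ n) x‖ₑ) ^ 2 :=
              pow_le_pow_left₀ zero_le (enorm_add_le _ _) 2
          _ ≤ _ := by
              have := ENNReal.rpow_add_le_mul_rpow_add_rpow
                ‖φ n x - ballAverage μ ε (φ n) x‖ₑ ‖ballAverage μ ε (φ n) x‖ₑ one_le_two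
              rw [← mul_add]
              norm_num at this
              exact this
    _ = 2 * ∫⁻ x in Ω, ‖φ n x - ballAverage μ ε (φ n) x‖ₑ ^ 2 ∂μ +
          2 * ∫⁻ x in Ω, ‖ballAverage μ ε (φ n) x‖ₑ ^ 2 ∂μ := by
        rw [lintegral_add_right _ ((hmeas n ε hε).const_mul 2),
          lintegral_const_mul' _ _ (by simp), lintegral_const_mul' _ _ (by simp)]
    _ ≤ η / 2 + η / 2 := by
        refine add_le_add (le_trans (mul_le_mul_right ?_ _) hεη) hn
        exact (setLIntegral_le_lintegral _ _).trans
          ((lintegral_enorm_sub_ballAverage_sq_le (hφ n) (hs n) hε).trans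
            (mul_le_mul_right (h1 n) _))
    _ = η := ENNReal.add_halves η

end Averages

end

noncomputable section

namespace BilinearStokesBrinkman

/-! ### The space `H_0^1` -/

section H10Lemmas

variable {d : ℕ} {Ω : Set (Vec d)}

/-- The embedding of `H_0^1` into `L²`. -/
def fieldL (Ω : Set (Vec d)) : H10 Ω →L[ℝ] L2Vec Ω :=
  WithLp.fstL 2 ℝ (L2Vec Ω) (PiLp 2 fun _ : Fin d => L2Vec Ω) ∘L
    (testJets Ω).topologicalClosure.subtypeL

/-- Weak differentiation `H_0^1 → L²`. -/
def partialDL (Ω : Set (Vec d)) (i : Fin d) : H10 Ω →L[ℝ] L2Vec Ω :=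
  PiLp.proj 2 (fun _ : Fin d => L2Vec Ω) i ∘L
    WithLp.sndL 2 ℝ (L2Vec Ω) (PiLp 2 fun _ : Fin d => L2Vec Ω) ∘L
      (testJets Ω).topologicalClosure.subtypeL

/-- The divergence `H_0^1 → L²`. -/
def divL (Ω : Set (Vec d)) : H10 Ω →L[ℝ] L2 Ω :=
  ∑ i, (EuclideanSpace.proj i : Vec d →L[ℝ] ℝ).compLpL 2 (volume.restrict Ω) ∘L partialDL Ω i

@[simp]
theorem fieldL_apply (y : H10 Ω) : fieldL Ω y = y.field := rfl

@[simp]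
theorem partialDL_apply (i : Fin d) (y : H10 Ω) : partialDL Ω i y = y.partialD i := rfl

theorem coeFn_divL (y : H10 Ω) : divL Ω y =ᵐ[volume.restrict Ω] y.div := by
  have h1 : divL Ω y = ∑ i, (EuclideanSpace.proj i : Vec d →L[ℝ] ℝ).compLpL 2
      (volume.restrict Ω) (y.partialD i) := by
    simp [divL]
  rw [h1]
  have h2 : ∀ᵐ x ∂(volume.restrict Ω), ∀ i, ((EuclideanSpace.proj i : Vec d →L[ℝ] ℝ).compLpL 2
      (volume.restrict Ω) (y.partialD i)) x = y.partialD i x i :=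
    ae_all_iff.2 fun i => ContinuousLinearMap.coeFn_compLpL _ _
  filter_upwards [Lp.coeFn_finsetSum Finset.univ fun i =>
    (EuclideanSpace.proj i : Vec d →L[ℝ] ℝ).compLpL 2 (volume.restrict Ω) (y.partialD i), h2]
    with x hx hx2
  rw [hx, Finset.sum_apply]
  simp only [hx2, H10.div]

theorem H10.norm_sq_eq (y : H10 Ω) : ‖y‖ ^ 2 = ‖y.field‖ ^ 2 + ∑ i, ‖y.partialD i‖ ^ 2 := by
  have h1 : ‖y‖ ^ 2 = ‖(y : L2Jet Ω)‖ ^ 2 := rfl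
  rw [h1, WithLp.prod_norm_sq_eq_of_L2, PiLp.norm_sq_eq_of_L2]
  rfl

theorem H10.norm_field_le (y : H10 Ω) : ‖y.field‖ ≤ ‖y‖ := by
  refine le_of_sq_le_sq ?_ (norm_nonneg _)
  rw [H10.norm_sq_eq]
  exact le_add_of_nonneg_right (Finset.sum_nonneg fun i _ => sq_nonneg _)

theorem H10.norm_partialD_le (y : H10 Ω) (i : Fin d) : ‖y.partialD i‖ ≤ ‖y‖ := by
  refine le_of_sq_le_sq ?_ (norm_nonneg _)
  rw [H10.norm_sq_eq]
  exact (Finset.single_le_sum (f := fun i => ‖y.partialD i‖ ^ 2) (fun i _ => sq_nonneg _)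
    (Finset.mem_univ i)).trans (le_add_of_nonneg_left (sq_nonneg _))

theorem exists_test_seq_tendsto (y : H10 Ω) :
    ∃ w : ℕ → H10 Ω, (∀ n, ∃ φ, IsTestField Ω φ ∧ IsJetOf Ω (w n).1 φ) ∧
      Tendsto w atTop (𝓝 y) := by
  obtain ⟨w, hw, hlim⟩ := mem_closure_iff_seq_limit.1 y.2
  exact ⟨fun n => ⟨w n, subset_closure (hw n)⟩, hw, tendsto_subtype_rng.2 hlim⟩

/-! ### The embedding into `L⁴` -/

theorem enorm_fderiv_le_sum (φ : Vec d → Vec d) (x : Vec d) :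
    ‖fderiv ℝ φ x‖ₑ ≤ ∑ i, ‖fderiv ℝ φ x (EuclideanSpace.single i 1)‖ₑ := by
  have h : ‖fderiv ℝ φ x‖ ≤ ∑ i, ‖fderiv ℝ φ x (EuclideanSpace.single i 1)‖ := by
    refine ContinuousLinearMap.opNorm_le_bound _ (Finset.sum_nonneg fun i _ => norm_nonneg _)
      fun v => ?_
    have hv : v = ∑ i, v i • EuclideanSpace.single i (1 : ℝ) := by
      conv_lhs => rw [← (EuclideanSpace.basisFun (Fin d) ℝ).sum_repr v]
      simp
    conv_lhs => rw [hv]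
    rw [map_sum, Finset.sum_mul]
    refine (norm_sum_le _ _).trans (Finset.sum_le_sum fun i _ => ?_)
    rw [map_smul, norm_smul, mul_comm]
    exact mul_le_mul_of_nonneg_left (PiLp.norm_apply_le v i) (norm_nonneg _)
  simp only [← ofReal_norm]
  rw [← ENNReal.ofReal_sum_of_nonneg fun i _ => norm_nonneg _]
  exact ENNReal.ofReal_le_ofReal h

/-- The factor `d` arises from bounding each of the `d` partial derivatives by the full norm. -/
theorem eLpNorm_fderiv_le {φ : Vec d → Vec d} (hφ : IsTestField Ω φ) {w : H10 Ω}
    (hw : IsJetOf Ω w.1 φ) :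
    eLpNorm (fderiv ℝ φ) 2 (volume.restrict Ω) ≤ d * ‖w‖ₑ := by
  have hc : Continuous (fderiv ℝ φ) := hφ.1.continuous_fderiv (by simp)
  have hci : ∀ i : Fin d, Continuous fun x => ‖fderiv ℝ φ x (EuclideanSpace.single i 1)‖ :=
    fun i => (hc.clm_apply continuous_const).norm
  calc eLpNorm (fderiv ℝ φ) 2 (volume.restrict Ω)
      ≤ eLpNorm (∑ i, fun x => ‖fderiv ℝ φ x (EuclideanSpace.single i 1)‖) 2
          (volume.restrict Ω) := by
        refine eLpNorm_mono_enorm fun x => (enorm_fderiv_le_sum φ x).trans (le_of_eq ?_)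
        rw [Finset.sum_apply, Real.enorm_of_nonneg (Finset.sum_nonneg fun i _ => norm_nonneg _),
          ENNReal.ofReal_sum_of_nonneg fun i _ => norm_nonneg _]
        simp only [ofReal_norm]
    _ ≤ ∑ i, eLpNorm (fun x => ‖fderiv ℝ φ x (EuclideanSpace.single i 1)‖) 2
          (volume.restrict Ω) :=
        eLpNorm_sum_le (fun i _ => (hci i).aestronglyMeasurable) (by norm_num)
    _ ≤ ∑ _i : Fin d, ‖w‖ₑ := by
        refine Finset.sum_le_sum fun i _ => ?_
        rw [eLpNorm_norm, ← eLpNorm_congr_ae (hw.2 i)]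
        rw [← Lp.enorm_def]
        exact enorm_le_iff_norm_le.2 (w.norm_partialD_le i)
    _ = d * ‖w‖ₑ := by simp

theorem IsTestField.eq_zero {φ : Vec d → Vec d} (hφ : IsTestField Ω φ) {x : Vec d} (hx : x ∉ Ω) :
    φ x = 0 :=
  image_eq_zero_of_notMem_tsupport fun h => hx (hφ.2.2 h)

theorem IsTestField.support_subset {φ : Vec d → Vec d} (hφ : IsTestField Ω φ) :
    Function.support φ ⊆ Ω :=
  (subset_tsupport φ).trans hφ.2.2

theorem IsTestField.support_fderiv_subset {φ : Vec d → Vec d} (hφ : IsTestField Ω φ) :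
    Function.support (fderiv ℝ φ) ⊆ Ω :=
  (_root_.support_fderiv_subset ℝ).trans hφ.2.2

/-- Gagliardo–Nirenberg–Sobolev with gradient exponent `12/7`: it lies below both dimensions, and
`7/12 - 1/d ≤ 1/4`, with equality for `d = 3`. Hölder on the bounded set then passes to the `L²`
norm of the gradient. -/
theorem exists_eLpNorm_four_le_of_isTestField (hd : d = 2 ∨ d = 3)
    (hΩ : Bornology.IsBounded Ω) :
    ∃ C : ℝ≥0∞, C ≠ ⊤ ∧ ∀ (w : H10 Ω) (φ : Vec d → Vec d), IsTestField Ω φ → IsJetOf Ω w.1 φ →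
      eLpNorm φ 4 volume ≤ C * ‖w‖ₑ := by
  have hfin : volume.restrict Ω Set.univ ≠ ⊤ := by
    simpa using hΩ.measure_lt_top.ne
  refine ⟨eLpNormLESNormFDerivOfLeConst (Vec d) (volume : Measure (Vec d)) Ω (12 / 7) 4 *
    (d * volume.restrict Ω Set.univ ^ (1 / ((12 / 7 : ℝ≥0) : ℝ≥0∞).toReal - 1 / ENNReal.toReal 2)),
    ?_, fun w φ hφ hw => ?_⟩
  · refine ENNReal.mul_ne_top ENNReal.coe_ne_top (ENNReal.mul_ne_top (by simp) ?_)
    refine ENNReal.rpow_ne_top_of_nonneg ?_ hfin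
    norm_num
  · have h1 := eLpNorm_le_eLpNorm_fderiv_of_le (volume : Measure (Vec d)) (u := φ) (s := Ω)
      (hφ.1.of_le (by simp)) hφ.support_subset (p := 12 / 7) (q := 4)
      (by rw [← NNReal.coe_le_coe]; norm_num)
      (by
        rcases hd with rfl | rfl <;> simp [← NNReal.coe_lt_coe] <;> norm_num)
      (by
        rcases hd with rfl | rfl <;> simp <;> norm_num) hΩ
    refine h1.trans ?_
    rw [mul_assoc]
    refine mul_le_mul_right ?_ _
    rw [← eLpNorm_restrict_eq_of_support_subset hφ.support_fderiv_subset]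
    refine (eLpNorm_le_eLpNorm_mul_rpow_measure_univ (q := 2) ?_ ?_).trans ?_
    · rw [show (2 : ℝ≥0∞) = ((2 : ℝ≥0) : ℝ≥0∞) from rfl, ENNReal.coe_le_coe,
        ← NNReal.coe_le_coe]
      norm_num
    · exact (hφ.1.continuous_fderiv (by simp)).aestronglyMeasurable
    · rw [mul_right_comm]
      exact mul_le_mul_left (eLpNorm_fderiv_le hφ hw) _

/-- The Sobolev embedding `H_0^1 ⊂ L⁴` in dimensions two and three. -/
theorem exists_eLpNorm_four_le (hd : d = 2 ∨ d = 3) (hΩ : Bornology.IsBounded Ω) :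
    ∃ C : ℝ≥0∞, C ≠ ⊤ ∧ ∀ y : H10 Ω, eLpNorm y.field 4 (volume.restrict Ω) ≤ C * ‖y‖ₑ := by
  obtain ⟨C, hC, h⟩ := exists_eLpNorm_four_le_of_isTestField hd hΩ
  refine ⟨C, hC, fun y => ?_⟩
  obtain ⟨w, hw, hlim⟩ := exists_test_seq_tendsto y
  have hbound : ∀ n, eLpNorm (w n).field 4 (volume.restrict Ω) ≤ C * ‖w n‖ₑ := fun n => by
    obtain ⟨φ, hφ, hj⟩ := hw n
    rw [eLpNorm_congr_ae (show (w n).field =ᵐ[volume.restrict Ω] φ from hj.1),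
      eLpNorm_restrict_eq_of_support_subset hφ.support_subset]
    exact h _ _ hφ hj
  have hf : Tendsto (fun n => (w n).field) atTop (𝓝 y.field) :=
    ((fieldL Ω).continuous.tendsto y).comp hlim
  -- An almost everywhere convergent subsequence makes the `L⁴` norm lower semicontinuous, by Fatou.
  obtain ⟨ns, hns, hae⟩ := (tendstoInMeasure_of_tendsto_Lp hf).exists_seq_tendsto_ae
  refine (Lp.eLpNorm_lim_le_liminf_eLpNorm (fun n => Lp.aestronglyMeasurable _) _ hae).trans ?_
  have h2 : Tendsto (fun n => C * ‖w (ns n)‖ₑ) atTop (𝓝 (C * ‖y‖ₑ)) :=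
    ENNReal.Tendsto.const_mul ((hlim.comp hns.tendsto_atTop).enorm) (Or.inr hC)
  rw [← h2.liminf_eq]
  exact liminf_le_liminf (Eventually.of_forall fun n => hbound (ns n))

instance fact_one_le_four : Fact ((1 : ℝ≥0∞) ≤ 4) := ⟨by norm_num⟩

instance holderTriple_four_four_two : ENNReal.HolderTriple 4 4 2 :=
  ⟨by
    rw [show (4 : ℝ≥0∞) = 2 * 2 by norm_num, ENNReal.mul_inv (by simp) (by simp), ← mul_add,
      ENNReal.inv_two_add_inv_two, mul_one]⟩

/-- The product `y · v ∈ L²` of elements of `H_0^1`, as a continuous bilinear map. -/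
theorem exists_dotProduct (hd : d = 2 ∨ d = 3) (hΩ : Bornology.IsBounded Ω) :
    ∃ P : H10 Ω →L[ℝ] H10 Ω →L[ℝ] L2 Ω, ∀ y v : H10 Ω,
      P y v =ᵐ[volume.restrict Ω] fun x => ⟪y.field x, v.field x⟫ := by
  obtain ⟨C, hC, h⟩ := exists_eLpNorm_four_le hd hΩ
  have hmem : ∀ y : H10 Ω, MemLp y.field 4 (volume.restrict Ω) := fun y =>
    ⟨Lp.aestronglyMeasurable _, (h y).trans_lt (ENNReal.mul_lt_top hC.lt_top enorm_lt_top)⟩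
  let J : H10 Ω →L[ℝ] Lp (Vec d) 4 (volume.restrict Ω) := LinearMap.mkContinuous
    { toFun := fun y => (hmem y).toLp _
      map_add' := fun y v => by
        rw [← MemLp.toLp_add]
        refine MemLp.toLp_congr _ _ ?_
        exact Lp.coeFn_add y.field v.field
      map_smul' := fun c y => by
        rw [RingHom.id_apply, ← MemLp.toLp_const_smul]
        refine MemLp.toLp_congr _ _ ?_
        exact Lp.coeFn_smul c y.field } C.toReal (fun y => by
      simp only [LinearMap.coe_mk, AddHom.coe_mk]
      rw [Lp.norm_toLp]
      refine (ENNReal.toReal_mono (by finiteness) (h y)).trans (le_of_eq ?_)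
      simp)
  refine ⟨(((innerSL ℝ (E := Vec d)).holderL (volume.restrict Ω) 4 4 2).bilinearComp J J),
    fun y v => ?_⟩
  have hJ : ∀ y, J y =ᵐ[volume.restrict Ω] y.field := fun y => MemLp.coeFn_toLp (hmem y)
  filter_upwards [(innerSL ℝ (E := Vec d)).coeFn_holder (r := 2) (J y) (J v), hJ y, hJ v]
    with x hx h1 h2
  rw [← h1, ← h2]
  exact hx

/-! ### The divergence has zero mean -/

/-- Integration by parts against the constant `1`. -/
theorem integral_fderiv_apply_eq_zero {φ : Vec d → Vec d} (hφ : ContDiff ℝ 1 φ)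
    (hs : HasCompactSupport φ) (v : Vec d) : ∫ x, fderiv ℝ φ x v = 0 := by
  have hc : Continuous (fderiv ℝ φ) := hφ.continuous_fderiv (by simp)
  have h1 : Integrable fun x => fderiv ℝ φ x v :=
    (hc.clm_apply continuous_const).integrable_of_hasCompactSupport
      ((hs.fderiv ℝ).comp_left (g := fun T : Vec d →L[ℝ] Vec d => T v) (by simp))
  have h2 : Integrable φ := hφ.continuous.integrable_of_hasCompactSupport hs
  have := integral_bilinear_fderiv_right_eq_neg_left_of_integrable (μ := (volume : Measure (Vec d)))
    (f := fun _ : Vec d => (1 : ℝ)) (g := φ) (v := v)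
    (B := ContinuousLinearMap.lsmul ℝ ℝ) (by simp) (by simpa using h1) (by simpa using h2)
    (fun x _ => differentiableAt_const _) (fun x _ => hφ.differentiable (by simp) x)
  simpa using this

/-- The integral is the pairing of `divL Ω y` with the constant `1`, hence continuous in `y`;
density of test fields suffices. -/
theorem integral_div_eq_zero (hΩ : Bornology.IsBounded Ω) (y : H10 Ω) :
    ∫ x in Ω, y.div x = 0 := by
  have hfin : volume.restrict Ω Set.univ ≠ ⊤ := by
    simpa using hΩ.measure_lt_top.ne
  have hrepr : ∀ y : H10 Ω, ∫ x in Ω, y.div x =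
      ⟪indicatorConstLp 2 MeasurableSet.univ hfin (1 : ℝ), divL Ω y⟫ := fun y => by
    rw [L2.inner_indicatorConstLp_eq_inner_setIntegral, Measure.restrict_univ,
      integral_congr_ae (coeFn_divL y)]
    simp
  obtain ⟨w, hw, hlim⟩ := exists_test_seq_tendsto y
  have h0 : ∀ n, ∫ x in Ω, (w n).div x = 0 := fun n => by
    obtain ⟨φ, hφ, hj⟩ := hw n
    have h1 : (w n).div =ᵐ[volume.restrict Ω]
        fun x => ∑ i, fderiv ℝ φ x (EuclideanSpace.single i 1) i := by
      have : ∀ᵐ x ∂(volume.restrict Ω), ∀ i : Fin d,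
          (w n).partialD i x = fderiv ℝ φ x (EuclideanSpace.single i 1) :=
        ae_all_iff.2 hj.2
      filter_upwards [this] with x hx
      simp only [H10.div, hx]
    have hc : Continuous (fderiv ℝ φ) := hφ.1.continuous_fderiv (by simp)
    have hint : ∀ i : Fin d, Integrable fun x => fderiv ℝ φ x (EuclideanSpace.single i 1) :=
      fun i => (hc.clm_apply continuous_const).integrable_of_hasCompactSupport
        ((hφ.2.1.fderiv ℝ).comp_left
          (g := fun T : Vec d →L[ℝ] Vec d => T (EuclideanSpace.single i 1)) (by simp))
    rw [integral_congr_ae h1, setIntegral_eq_integral_of_forall_compl_eq_zero, integral_finsetSum]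
    · refine Finset.sum_eq_zero fun i _ => ?_
      have h2 := (EuclideanSpace.proj i : Vec d →L[ℝ] ℝ).integral_comp_comm (hint i)
      rw [integral_fderiv_apply_eq_zero (hφ.1.of_le (by simp)) hφ.2.1, map_zero] at h2
      exact h2
    · exact fun i _ => (EuclideanSpace.proj i : Vec d →L[ℝ] ℝ).integrable_comp (hint i)
    · intro x hx
      have : fderiv ℝ φ x = 0 := by
        by_contra h
        exact hx (hφ.support_fderiv_subset h)
      simp [this]
  have hc : Tendsto (fun n => ∫ x in Ω, (w n).div x) atTop (𝓝 (∫ x in Ω, y.div x)) := by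
    simp_rw [hrepr]
    exact ((innerSL ℝ _ ∘L divL Ω).continuous.tendsto y).comp hlim
  simp only [h0] at hc
  exact (tendsto_nhds_unique hc tendsto_const_nhds)

/-- The divergence has zero mean, so it is itself an allowed multiplier, and this choice makes its
`L²` norm vanish. -/
theorem mem_divFree_of_forall_integral_eq_zero (hΩ : Bornology.IsBounded Ω) {y : H10 Ω}
    (h : ∀ q ∈ L20 Ω, ∫ x in Ω, q x * y.div x = 0) : y ∈ divFree Ω := by
  have hmem : divL Ω y ∈ L20 Ω := by
    change ∫ x in Ω, divL Ω y x = 0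
    rw [integral_congr_ae (coeFn_divL y)]
    exact integral_div_eq_zero hΩ y
  have h1 := h _ hmem
  have h2 : ⟪divL Ω y, divL Ω y⟫ = 0 := by
    rw [L2.inner_def, ← h1]
    refine integral_congr_ae ?_
    filter_upwards [coeFn_divL y] with x hx
    simp [hx, sq]
  have h3 : divL Ω y = 0 := inner_self_eq_zero.1 h2
  have h4 := coeFn_divL y
  rw [h3] at h4
  exact h4.symm.trans (Lp.coeFn_zero _ _ _)

theorem divL_eq_zero_iff {y : H10 Ω} : divL Ω y = 0 ↔ y ∈ divFree Ω := by
  refine ⟨fun h => ?_, fun h => ?_⟩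
  · have h4 := coeFn_divL y
    rw [h] at h4
    exact h4.symm.trans (Lp.coeFn_zero _ _ _)
  · have h' : y.div =ᵐ[volume.restrict Ω] 0 := h
    exact Lp.ext ((coeFn_divL y).trans (h'.trans (Lp.coeFn_zero _ _ _).symm))

/-! ### The compact embedding into `L²` -/

/-- The Rellich theorem: weakly null sequences in `H_0^1` tend to zero in `L²`. -/
theorem tendsto_field_of_weakTendsto_zero (hΩ : Bornology.IsBounded Ω) {y : ℕ → H10 Ω}
    (hy : WeakTendsto y 0) : Tendsto (fun n => (y n).field) atTop (𝓝 0) := by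
  -- Test fields within `1 / (n + 1)` of `y n` have the same weak limit, and `L²` convergence
  -- transfers back.
  have happ : ∀ n, ∃ w : H10 Ω, (∃ φ, IsTestField Ω φ ∧ IsJetOf Ω w.1 φ) ∧
      ‖w - y n‖ ≤ 1 / ((n : ℝ) + 1) := fun n => by
    obtain ⟨w, hw, hlim⟩ := exists_test_seq_tendsto (y n)
    obtain ⟨k, hk⟩ := ((tendsto_iff_norm_sub_tendsto_zero.1 hlim).eventually
      (eventually_le_nhds (show (0 : ℝ) < 1 / ((n : ℝ) + 1) by positivity))).exists
    exact ⟨w k, hw k, hk⟩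
  choose w hw hwy using happ
  choose φ hφ hj using hw
  have hwy0 : Tendsto (fun n => w n - y n) atTop (𝓝 0) :=
    squeeze_zero_norm hwy tendsto_one_div_add_atTop_nhds_zero_nat
  have hweak : WeakTendsto w 0 := fun v => by
    have h1 := (hy v).add (((innerSL ℝ v).continuous.tendsto 0).comp hwy0)
    rw [map_zero, add_zero] at h1
    refine h1.congr fun n => ?_
    change ⟪v, y n⟫ + ⟪v, w n - y n⟫ = ⟪v, w n⟫
    rw [← inner_add_right, add_sub_cancel]
  obtain ⟨M, hM⟩ := hweak.isBounded
  have hM0 : 0 ≤ M := (norm_nonneg _).trans (hM 0)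
  have hMe : ∀ n, ‖w n‖ₑ ≤ ENNReal.ofReal M := fun n => by
    rw [← ofReal_norm]; exact ENNReal.ofReal_le_ofReal (hM n)
  have hsq : ∀ {G : Type} [NormedAddCommGroup G] (f : Vec d → G) (μ : Measure (Vec d)),
      eLpNorm f 2 μ ^ 2 = ∫⁻ x, ‖f x‖ₑ ^ 2 ∂μ := fun f μ => by
    have := eLpNorm_nnreal_pow_eq_lintegral (f := f) (μ := μ) (p := 2) (by norm_num)
    simpa using this
  have hL2 : ∀ n, ‖(w n).field‖ₑ ^ 2 = ∫⁻ x in Ω, ‖φ n x‖ₑ ^ 2 := fun n => by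
    rw [Lp.enorm_def, eLpNorm_congr_ae (show (w n).field =ᵐ[volume.restrict Ω] φ n from (hj n).1),
      hsq]
  have hfull : ∀ n, eLpNorm (φ n) 2 volume ≤ ENNReal.ofReal M := fun n => by
    rw [← eLpNorm_restrict_eq_of_support_subset (hφ n).support_subset,
      ← eLpNorm_congr_ae (show (w n).field =ᵐ[volume.restrict Ω] φ n from (hj n).1),
      ← Lp.enorm_def]
    exact (enorm_le_iff_norm_le.2 (w n).norm_field_le).trans (hMe n)
  have hgrad : ∀ n, eLpNorm (fderiv ℝ (φ n)) 2 volume ≤ d * ENNReal.ofReal M := fun n => by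
    have h1 := eLpNorm_restrict_eq_of_support_subset (p := 2) (μ := volume)
      (hφ n).support_fderiv_subset
    rw [← h1]
    exact (eLpNorm_fderiv_le (hφ n) (hj n)).trans (mul_le_mul_right (hMe n) _)
  -- Ball integrals are, coordinate by coordinate, pairings with indicators in `L²`, so weak
  -- convergence controls them.
  have hball : ∀ x ε, Tendsto (fun n => ∫ z in Metric.ball x ε, φ n z) atTop (𝓝 0) := by
    intro x ε
    have hfin : volume.restrict Ω (Metric.ball x ε) ≠ ⊤ :=
      ((Measure.restrict_apply_le _ _).trans_lt measure_ball_lt_top).ne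
    have hcoord : ∀ c : Vec d, Tendsto (fun n => ⟪c, ∫ z in Metric.ball x ε, φ n z⟫) atTop
        (𝓝 0) := fun c => by
      have h1 := (hweak.map (fieldL Ω)) (indicatorConstLp 2 measurableSet_ball hfin c)
      simp only [map_zero, inner_zero_right, fieldL_apply,
        L2.inner_indicatorConstLp_eq_inner_setIntegral] at h1
      refine h1.congr fun n => ?_
      congr 1
      rw [setIntegral_congr_ae measurableSet_ball
          (f := (w n).field) (g := φ n) ((hj n).1.mono fun z hz _ => hz),
        ← integral_indicator measurableSet_ball, ← integral_indicator measurableSet_ball,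
        setIntegral_eq_integral_of_forall_compl_eq_zero]
      intro z hz
      simp [Set.indicator, (hφ n).eq_zero hz]
    have hsum := tendsto_finsetSum Finset.univ fun i (_ : i ∈ Finset.univ) =>
      (hcoord (EuclideanSpace.basisFun (Fin d) ℝ i)).smul_const
        (EuclideanSpace.basisFun (Fin d) ℝ i)
    simpa only [OrthonormalBasis.sum_repr', zero_smul, Finset.sum_const_zero] using hsum
  have key := tendsto_lintegral_enorm_sq_zero (μ := (volume : Measure (Vec d))) (Ω := Ω)
    hΩ.measure_lt_top.ne (φ := φ) (fun n => (hφ n).1.of_le (by simp)) (fun n => (hφ n).2.1)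
    (M := ENNReal.ofReal M ^ 2 + (d * ENNReal.ofReal M) ^ 2) (by finiteness)
    (fun n => by
      rw [← hsq]
      exact (pow_le_pow_left₀ zero_le (hfull n) 2).trans (le_add_of_nonneg_right zero_le))
    (fun n => by
      rw [← hsq]
      exact (pow_le_pow_left₀ zero_le (hgrad n) 2).trans (le_add_of_nonneg_left zero_le)) hball
  have hw0 : Tendsto (fun n => (w n).field) atTop (𝓝 0) := by
    rw [tendsto_zero_iff_norm_tendsto_zero]
    have h1 := (ENNReal.tendsto_toReal ENNReal.zero_ne_top).comp key
    simp only [Function.comp_def, ← hL2, ENNReal.toReal_pow, toReal_enorm,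
      ENNReal.toReal_zero] at h1
    simpa using h1.sqrt
  have hlast := hw0.sub (((fieldL Ω).continuous.tendsto 0).comp hwy0)
  rw [map_zero, sub_zero] at hlast
  refine hlast.congr fun n => ?_
  rw [Function.comp_apply, map_sub, fieldL_apply, fieldL_apply, sub_sub_cancel]

/-- Multiplication with a fixed element of `H_0^1` is compact from `H_0^1` to `L²`. -/
theorem tendsto_dotProduct_of_weakTendsto_zero (hΩ : Bornology.IsBounded Ω)
    {P : H10 Ω →L[ℝ] H10 Ω →L[ℝ] L2 Ω}
    (hP : ∀ y v : H10 Ω, P y v =ᵐ[volume.restrict Ω] fun x => ⟪y.field x, v.field x⟫)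
    {y : ℕ → H10 Ω} (hy : WeakTendsto y 0) (z : H10 Ω) :
    Tendsto (fun n => P (y n) z) atTop (𝓝 0) := by
  obtain ⟨M, hM⟩ := hy.isBounded
  have hM0 : 0 ≤ M := (norm_nonneg _).trans (hM 0)
  -- A bounded test field replaces `z` at an error uniform in `n`; for the bounded factor Rellich's
  -- theorem applies.
  obtain ⟨w, hw, hlim⟩ := exists_test_seq_tendsto z
  rw [Metric.tendsto_nhds]
  intro ε hε
  have h1 : Tendsto (fun k => ‖P‖ * M * ‖w k - z‖) atTop (𝓝 0) := by
    simpa using (tendsto_iff_norm_sub_tendsto_zero.1 hlim).const_mul (‖P‖ * M)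
  obtain ⟨k, hk⟩ := (h1.eventually (eventually_lt_nhds (half_pos hε))).exists
  obtain ⟨φ, hφ, hj⟩ := hw k
  obtain ⟨B, hB⟩ := hφ.1.continuous.bounded_above_of_compact_support hφ.2.1
  have hPw : ∀ n, ‖P (y n) (w k)‖ ≤ B * ‖(y n).field‖ := fun n => by
    refine Lp.norm_le_mul_norm_of_ae_le_mul ?_
    filter_upwards [hP (y n) (w k), hj.1] with x hx hx2
    rw [hx]
    change ‖⟪(y n).field x, (w k).1.fst x⟫‖ ≤ _
    rw [hx2, mul_comm]
    exact (norm_inner_le_norm _ _).trans (mul_le_mul_of_nonneg_left (hB x) (norm_nonneg _))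
  have h2 : Tendsto (fun n => B * ‖(y n).field‖) atTop (𝓝 0) := by
    simpa using (tendsto_field_of_weakTendsto_zero hΩ hy).norm.const_mul B
  filter_upwards [h2.eventually (eventually_lt_nhds (half_pos hε))] with n hn
  rw [dist_zero_right]
  have h3 : P (y n) z = P (y n) (w k) - P (y n) (w k - z) := by simp
  have h4 : ‖P (y n) (w k - z)‖ ≤ ‖P‖ * M * ‖w k - z‖ := by
    refine (P.le_opNorm₂ _ _).trans ?_
    gcongr
    exact hM n
  rw [h3]
  linarith [norm_sub_le (P (y n) (w k)) (P (y n) (w k - z)), hPw n]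

end H10Lemmas

end BilinearStokesBrinkman

end

/-! ### Coercive forms and the dual space -/

noncomputable section

/-- A coercive form on a Hilbert space induces an isomorphism onto the dual space. -/
theorem IsCoercive.exists_continuousLinearEquiv_dual {V : Type*} [NormedAddCommGroup V]
    [InnerProductSpace ℝ V] [CompleteSpace V] {B : V →L[ℝ] V →L[ℝ] ℝ} (hB : IsCoercive B) :
    ∃ A : V ≃L[ℝ] (V →L[ℝ] ℝ), ∀ v, A v = B v := by
  have hinj : B.ker = ⊥ := by
    rw [LinearMap.ker_eq_bot']
    intro v hv
    obtain ⟨C, hC, h⟩ := hB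
    have h1 := h v
    have h2 : B v v = 0 := by
      change (B v : V →L[ℝ] ℝ) = 0 at hv
      rw [hv]; rfl
    rw [h2] at h1
    by_contra hne
    have : 0 < C * ‖v‖ * ‖v‖ := by
      have := norm_pos_iff.2 hne
      positivity
    linarith
  have hsurj : B.range = ⊤ := by
    rw [LinearMap.range_eq_top]
    intro F
    refine ⟨hB.continuousLinearEquivOfBilin.symm ((InnerProductSpace.toDual ℝ V).symm F), ?_⟩
    ext w
    have := hB.continuousLinearEquivOfBilin_apply
      (hB.continuousLinearEquivOfBilin.symm ((InnerProductSpace.toDual ℝ V).symm F)) w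
    rw [ContinuousLinearEquiv.apply_symm_apply, InnerProductSpace.toDual_symm_apply] at this
    exact this.symm
  exact ⟨ContinuousLinearEquiv.ofBijective B hinj hsurj, fun v => rfl⟩

namespace BilinearStokesBrinkman

variable {d : ℕ} {Ω : Set (Vec d)}

/-! ### The Brinkman form -/

/-- The divergence-free fields form a Hilbert space, isometrically embedded into `H_0^1`. -/
theorem exists_divFree_hilbert (Ω : Set (Vec d)) :
    ∃ (V : Type) (_ : NormedAddCommGroup V) (_ : InnerProductSpace ℝ V) (_ : CompleteSpace V)
      (e : V →L[ℝ] H10 Ω), (∀ v, ‖e v‖ = ‖v‖) ∧ ∀ y, y ∈ divFree Ω ↔ ∃ v, e v = y := by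
  refine ⟨(divL Ω).ker, inferInstance, inferInstance, inferInstance, (divL Ω).ker.subtypeL,
    fun v => rfl, fun y => ?_⟩
  rw [← divL_eq_zero_iff]
  exact ⟨fun h => ⟨⟨y, h⟩, rfl⟩, fun ⟨v, hv⟩ => hv ▸ v.2⟩

/-- `(∇y, ∇v)`. -/
def gradForm (Ω : Set (Vec d)) : H10 Ω →L[ℝ] H10 Ω →L[ℝ] ℝ :=
  ∑ i, (innerSL ℝ).bilinearComp (partialDL Ω i) (partialDL Ω i)

theorem gradForm_apply (y v : H10 Ω) :
    gradForm Ω y v = ∑ i, ⟪y.partialD i, v.partialD i⟫ := by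
  simp [gradForm]

/-- Almost everywhere equality is allowed because `secondDerivLInf` uses the pointwise sum `u x + h
x`, not the representative of a sum of classes. -/
theorem brinkmanForm_eq {P : H10 Ω →L[ℝ] H10 Ω →L[ℝ] L2 Ω}
    (hP : ∀ y v : H10 Ω, P y v =ᵐ[volume.restrict Ω] fun x => ⟪y.field x, v.field x⟫)
    {c : Vec d → ℝ} {u : L2 Ω} (hc : c =ᵐ[volume.restrict Ω] u) (y v : H10 Ω) :
    brinkmanForm c y v = gradForm Ω y v + ⟪u, P y v⟫ := by
  rw [brinkmanForm, gradForm_apply, L2.inner_def]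
  congr 1
  refine integral_congr_ae ?_
  filter_upwards [hP y v, hc] with x hx hcx
  rw [hcx, hx]
  simp [mul_comm]

/-- The lower-order term controls the field and the gradient term the derivatives, whence the
constant `min 1 a`. -/
theorem coercive_brinkman {P : H10 Ω →L[ℝ] H10 Ω →L[ℝ] L2 Ω}
    (hP : ∀ y v : H10 Ω, P y v =ᵐ[volume.restrict Ω] fun x => ⟪y.field x, v.field x⟫)
    {a : ℝ} {u : L2 Ω} (hu : ∀ᵐ x ∂(volume.restrict Ω), a ≤ u x) (y : H10 Ω) :
    min 1 a * ‖y‖ ^ 2 ≤ gradForm Ω y y + ⟪u, P y y⟫ := by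
  have h1 : a * ‖y.field‖ ^ 2 ≤ ⟪u, P y y⟫ := by
    rw [← real_inner_self_eq_norm_sq, L2.inner_def, L2.inner_def, ← integral_const_mul]
    refine integral_mono_ae ((L2.integrable_inner _ _).const_mul a) (L2.integrable_inner _ _) ?_
    filter_upwards [hP y y, hu] with x hx hux
    rw [hx, real_inner_self_eq_norm_sq]
    simp only [RCLike.inner_apply, conj_trivial]
    rw [mul_comm]
    exact mul_le_mul_of_nonneg_left hux (sq_nonneg _)
  have h2 : gradForm Ω y y = ∑ i, ‖y.partialD i‖ ^ 2 := by
    simp [gradForm_apply]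
  have h3 : 0 ≤ ∑ i, ‖y.partialD i‖ ^ 2 := Finset.sum_nonneg fun i _ => sq_nonneg _
  rw [H10.norm_sq_eq, h2, mul_add]
  have h4 : min 1 a * ‖y.field‖ ^ 2 ≤ a * ‖y.field‖ ^ 2 :=
    mul_le_mul_of_nonneg_right (min_le_right _ _) (sq_nonneg _)
  have h5 : min 1 a * ∑ i, ‖y.partialD i‖ ^ 2 ≤ 1 * ∑ i, ‖y.partialD i‖ ^ 2 :=
    mul_le_mul_of_nonneg_right (min_le_left _ _) h3
  linarith

section Reduction

variable {V : Type*} [NormedAddCommGroup V] [InnerProductSpace ℝ V] [CompleteSpace V]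
  {e : V →L[ℝ] H10 Ω}

theorem exists_brinkmanEquiv (he : ∀ v, ‖e v‖ = ‖v‖) {P : H10 Ω →L[ℝ] H10 Ω →L[ℝ] L2 Ω}
    (hP : ∀ y v : H10 Ω, P y v =ᵐ[volume.restrict Ω] fun x => ⟪y.field x, v.field x⟫)
    {a : ℝ} (ha : 0 < a) {u : L2 Ω} (hu : ∀ᵐ x ∂(volume.restrict Ω), a ≤ u x) :
    ∃ A : V ≃L[ℝ] (V →L[ℝ] ℝ), ∀ y v : V,
      A y v = gradForm Ω (e y) (e v) + ⟪u, P (e y) (e v)⟫ := by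
  have hB : IsCoercive ((gradForm Ω).bilinearComp e e + pairingForm (P.bilinearComp e e) u) :=
    ⟨min 1 a, lt_min one_pos ha, fun y => by
      have := coercive_brinkman hP hu (e y)
      rw [he] at this
      rw [mul_assoc, ← sq]
      exact this⟩
  obtain ⟨A, hA⟩ := hB.exists_continuousLinearEquiv_dual
  exact ⟨A, fun y v => by rw [hA]; rfl⟩

/-! ### The reduced cost near an admissible control -/

variable (hr : ∀ y, y ∈ divFree Ω ↔ ∃ v, e v = y)
  {P : H10 Ω →L[ℝ] H10 Ω →L[ℝ] L2 Ω}
  (hP : ∀ y v : H10 Ω, P y v =ᵐ[volume.restrict Ω] fun x => ⟪y.field x, v.field x⟫)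
  {ubar : L2 Ω} {A : V ≃L[ℝ] (V →L[ℝ] ℝ)}
  (hA : ∀ y v : V, A y v = gradForm Ω (e y) (e v) + ⟪ubar, P (e y) (e v)⟫)

include hr hP hA

theorem solvesReducedState_iff {f : HNegOne Ω} {h : L2 Ω} {c : Vec d → ℝ}
    (hc : c =ᵐ[volume.restrict Ω] (ubar + h : L2 Ω)) (y : V) :
    SolvesReducedState f c (e y) ↔
      A y + pairingForm (P.bilinearComp e e) h y = f ∘L e := by
  have key : ∀ v : V, brinkmanForm c (e y) (e v) =
      (A y + pairingForm (P.bilinearComp e e) h y) v := fun v => by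
    rw [brinkmanForm_eq hP hc, inner_add_left, ← add_assoc, ← hA]
    rfl
  constructor
  · intro hy
    ext v
    rw [← key]
    exact hy.2 _ ((hr _).2 ⟨v, rfl⟩)
  · intro hy
    refine ⟨(hr _).2 ⟨y, rfl⟩, fun v hv => ?_⟩
    obtain ⟨v, rfl⟩ := (hr _).1 hv
    rw [key, hy]
    rfl

/-- Uniqueness identifies the chosen solution. Invertibility replaces positivity of `ubar + h`,
which may fail in an `L²` ball. -/
theorem controlToVelocity_eq {f : HNegOne Ω} {h : L2 Ω} {c : Vec d → ℝ}
    (hc : c =ᵐ[volume.restrict Ω] (ubar + h : L2 Ω))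
    (hinv : ((A : V →L[ℝ] V →L[ℝ] ℝ) + pairingForm (P.bilinearComp e e) h).IsInvertible) :
    controlToVelocity f c = e (perturbedState A (P.bilinearComp e e) (f ∘L e) h) := by
  have hex : ∃ y : H10 Ω, SolvesReducedState f c y :=
    ⟨_, (solvesReducedState_iff hr hP hA hc _).2 (perturbedState_spec A _ _ hinv)⟩
  rw [controlToVelocity, dif_pos hex]
  have hs := hex.choose_spec
  obtain ⟨v, hv⟩ := (hr _).1 hs.1
  rw [← hv] at hs ⊢
  rw [perturbedState_unique A _ _ hinv ((solvesReducedState_iff hr hP hA hc v).1 hs)]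

theorem reducedCost_eq {f : HNegOne Ω} {α : ℝ} {yΩ : L2Vec Ω} {h : L2 Ω} {c : Vec d → ℝ}
    (hc : c =ᵐ[volume.restrict Ω] (ubar + h : L2 Ω))
    (hinv : ((A : V →L[ℝ] V →L[ℝ] ℝ) + pairingForm (P.bilinearComp e e) h).IsInvertible) :
    reducedCost f α yΩ c =
      perturbedCost A (P.bilinearComp e e) (f ∘L e) (fieldL Ω ∘L e) yΩ α ubar h := by
  rw [reducedCost, cost, controlToVelocity_eq hr hP hA hc hinv, perturbedCost]
  have h1 : ∫ x in Ω, c x ^ 2 = ‖ubar + h‖ ^ 2 := by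
    rw [← real_inner_self_eq_norm_sq, L2.inner_def]
    refine integral_congr_ae ?_
    filter_upwards [hc] with x hx
    rw [hx]
    simp [sq]
  rw [h1]
  rfl

end Reduction

/-! ### The second derivative -/

theorem exists_linf_to_l2 (hΩ : Bornology.IsBounded Ω) :
    ∃ J : LInf Ω →L[ℝ] L2 Ω, ∀ h : LInf Ω, J h =ᵐ[volume.restrict Ω] h := by
  have : IsFiniteMeasure (volume.restrict Ω) := ⟨by simpa using hΩ.measure_lt_top⟩
  have hmem : ∀ h : LInf Ω, MemLp h 2 (volume.restrict Ω) := fun h =>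
    (Lp.memLp h).mono_exponent le_top
  let c : ℝ≥0∞ := volume.restrict Ω Set.univ ^ (1 / (2 : ℝ≥0∞).toReal - 1 / (⊤ : ℝ≥0∞).toReal)
  have hc : c ≠ ⊤ := ENNReal.rpow_ne_top_of_nonneg (by simp) (measure_ne_top _ _)
  refine ⟨LinearMap.mkContinuous
    { toFun := fun h => (hmem h).toLp _
      map_add' := fun h k => by
        rw [← MemLp.toLp_add]
        exact MemLp.toLp_congr _ _ (Lp.coeFn_add h k)
      map_smul' := fun t h => by
        rw [RingHom.id_apply, ← MemLp.toLp_const_smul]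
        exact MemLp.toLp_congr _ _ (Lp.coeFn_smul t h) } c.toReal (fun h => ?_),
    fun h => MemLp.coeFn_toLp (hmem h)⟩
  simp only [LinearMap.coe_mk, AddHom.coe_mk]
  rw [Lp.norm_toLp, Lp.norm_def, ← ENNReal.toReal_mul, mul_comm]
  refine ENNReal.toReal_mono (ENNReal.mul_ne_top (Lp.memLp h).2.ne hc) ?_
  exact eLpNorm_le_eLpNorm_mul_rpow_measure_univ le_top (Lp.aestronglyMeasurable h)

/-- Simple functions are bounded and dense. Density is what gives the extension in `secondDeriv` a
definite value. -/
theorem dense_memLp_top (Ω : Set (Vec d)) : Dense {v : L2 Ω | MemLp v ⊤ (volume.restrict Ω)} := by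
  refine (Lp.simpleFunc.dense (E := ℝ) (μ := volume.restrict Ω) (p := 2) (by simp)).mono ?_
  intro v hv
  have h1 := Lp.simpleFunc.toSimpleFunc_eq_toFun (⟨v, hv⟩ : Lp.simpleFunc ℝ 2 (volume.restrict Ω))
  exact (memLp_congr_ae h1).1 (SimpleFunc.memLp_top _ _)

/-- On `L^∞` the formula comes from the expansion of the cost; its right-hand side is continuous on
`L²`, hence equals the extension. -/
theorem secondDeriv_eq {V : Type*} [NormedAddCommGroup V] [InnerProductSpace ℝ V]
    [CompleteSpace V] {e : V →L[ℝ] H10 Ω} (hr : ∀ y, y ∈ divFree Ω ↔ ∃ v, e v = y)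
    (hΩ : Bornology.IsBounded Ω) {P : H10 Ω →L[ℝ] H10 Ω →L[ℝ] L2 Ω}
    (hP : ∀ y v : H10 Ω, P y v =ᵐ[volume.restrict Ω] fun x => ⟪y.field x, v.field x⟫)
    {ubar : L2 Ω} {A : V ≃L[ℝ] (V →L[ℝ] ℝ)}
    (hA : ∀ y v : V, A y v = gradForm Ω (e y) (e v) + ⟪ubar, P (e y) (e v)⟫)
    {f : HNegOne Ω} {α : ℝ} {yΩ : L2Vec Ω} {ybar zbar : V}
    (hy : A ybar = f ∘L e)
    (hz : ∀ φ : V, A φ zbar = ⟪(e ybar).field - yΩ, (e φ).field⟫)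
    (v : L2 Ω) :
    secondDeriv f α yΩ ubar v = α * ‖v‖ ^ 2 + curvatureForm A (P.bilinearComp e e)
      (fieldL Ω ∘L e) ybar zbar v := by
  obtain ⟨J, hJ⟩ := exists_linf_to_l2 hΩ
  obtain ⟨r, hr0, hinv⟩ := exists_isInvertible_add_pairingForm A (P.bilinearComp e e)
  have hsec : ∀ v : LInf Ω, secondDerivLInf f α yΩ ubar v = α * ‖J v‖ ^ 2 +
      curvatureForm A (P.bilinearComp e e) (fieldL Ω ∘L e) ybar zbar (J v) := fun v => by
    refine fderiv_fderiv_eq_of_eq_perturbedCost A (P.bilinearComp e e) (f ∘L e) (fieldL Ω ∘L e)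
      yΩ α ubar J hr0 (fun h hh => reducedCost_eq hr hP hA ?_ (hinv _ hh)) hy hz v
    filter_upwards [Lp.coeFn_add ubar (J h), hJ h] with x hx hx2
    rw [hx, Pi.add_apply, hx2]
  have hqc : Continuous fun v : L2 Ω => α * ‖v‖ ^ 2 +
      curvatureForm A (P.bilinearComp e e) (fieldL Ω ∘L e) ybar zbar v :=
    ((continuous_norm.pow 2).const_mul α).add (continuous_curvatureForm A _ _ ybar zbar)
  refine extendFrom_eq (dense_memLp_top Ω v) ?_
  refine ((hqc.tendsto v).mono_left nhdsWithin_le_nhds).congr' ?_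
  filter_upwards [self_mem_nhdsWithin] with w hw
  have hw' : MemLp w ⊤ (volume.restrict Ω) := hw
  have hJw : J (hw'.toLp w) = w := Lp.ext ((hJ _).trans (MemLp.coeFn_toLp hw'))
  rw [dif_pos hw', hsec, hJw]

/-! ### Critical directions -/

/-- Indicators of subsets of `E` are admissible tests, so the sign of integrals over them survives
the weak limit. -/
theorem ae_nonneg_of_weakTendsto {v : ℕ → L2 Ω} {v₀ : L2 Ω} (hΩ : Bornology.IsBounded Ω)
    (hv : WeakTendsto v v₀) {E : Set (Vec d)} (hE : MeasurableSet E)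
    (hnn : ∀ n, ∀ᵐ x ∂(volume.restrict Ω), x ∈ E → 0 ≤ v n x) :
    ∀ᵐ x ∂(volume.restrict Ω), x ∈ E → 0 ≤ v₀ x := by
  have : IsFiniteMeasure (volume.restrict Ω) := ⟨by simpa using hΩ.measure_lt_top⟩
  have hint : Integrable v₀ (volume.restrict Ω) := (Lp.memLp v₀).integrable (by norm_num)
  rw [← ae_restrict_iff' hE]
  refine ae_nonneg_restrict_of_forall_setIntegral_nonneg_inter hint.integrableOn
    fun s hs _ => ?_
  have hfin : volume.restrict Ω (s ∩ E) ≠ ⊤ := measure_ne_top _ _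
  have h1 := hv (indicatorConstLp 2 (hs.inter hE) hfin (1 : ℝ))
  simp only [L2.inner_indicatorConstLp_eq_inner_setIntegral] at h1
  simp only [RCLike.inner_apply, conj_trivial, mul_one] at h1
  refine ge_of_tendsto' h1 fun n => setIntegral_nonneg_of_ae_restrict ?_
  rw [EventuallyLE, ae_restrict_iff' (hs.inter hE)]
  filter_upwards [hnn n] with x hx hxs
  exact hx hxs.2

theorem coeFn_smul_sub_dotProduct {P : H10 Ω →L[ℝ] H10 Ω →L[ℝ] L2 Ω}
    (hP : ∀ y v : H10 Ω, P y v =ᵐ[volume.restrict Ω] fun x => ⟪y.field x, v.field x⟫)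
    (α : ℝ) (u : L2 Ω) (y z : H10 Ω) :
    (α • u - P y z : L2 Ω) =ᵐ[volume.restrict Ω] reducedGradient α u y z := by
  filter_upwards [Lp.coeFn_sub (α • u) (P y z), Lp.coeFn_smul α u, hP y z] with x h1 h2 h3
  rw [h1, Pi.sub_apply, h2, h3]
  rfl

theorem measurable_reducedGradient (α : ℝ) (u : L2 Ω) (y z : H10 Ω) :
    Measurable (reducedGradient α u y z) :=
  ((Lp.stronglyMeasurable u).measurable.const_mul α).sub
    ((Lp.stronglyMeasurable y.field).measurable.inner (Lp.stronglyMeasurable z.field).measurable)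

/-- The pointwise form of the variational inequality. -/
theorem ae_eq_of_variationalInequality {a b : ℝ} (hab : a < b) (hΩ : Bornology.IsBounded Ω)
    {g : L2 Ω} {D : Vec d → ℝ} (hD : Measurable D) (hg : g =ᵐ[volume.restrict Ω] D)
    {u : L2 Ω} (hu : u ∈ admissible Ω a b)
    (h : ∀ w ∈ admissible Ω a b, 0 ≤ ∫ x in Ω, D x * (w x - u x)) :
    ∀ᵐ x ∂(volume.restrict Ω), (0 < D x → u x = a) ∧ (D x < 0 → u x = b) := by
  have : IsFiniteMeasure (volume.restrict Ω) := ⟨by simpa using hΩ.measure_lt_top⟩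
  have hu' : ∀ᵐ x ∂(volume.restrict Ω), a ≤ u x ∧ u x ≤ b := hu
  -- A pointwise minimizer of `w ↦ D x * w` over `[a, b]`: the integrand is then nonpositive while
  -- its integral is not negative, so it vanishes almost everywhere.
  let w₀ : Vec d → ℝ := fun x => if 0 < D x then a else if D x < 0 then b else u x
  have hw₀m : Measurable w₀ :=
    Measurable.ite (measurableSet_lt measurable_const hD) measurable_const
      (Measurable.ite (measurableSet_lt hD measurable_const) measurable_const
        (Lp.stronglyMeasurable u).measurable)
  have hw₀b : ∀ᵐ x ∂(volume.restrict Ω), a ≤ w₀ x ∧ w₀ x ≤ b := by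
    filter_upwards [hu'] with x hx
    simp only [w₀]
    split_ifs
    · exact ⟨le_rfl, hab.le⟩
    · exact ⟨hab.le, le_rfl⟩
    · exact hx
  have hw₀L : MemLp w₀ 2 (volume.restrict Ω) :=
    MemLp.of_bound hw₀m.aestronglyMeasurable (max |a| |b|) (hw₀b.mono fun x hx => by
      rw [Real.norm_eq_abs]
      exact abs_le_max_abs_abs hx.1 hx.2)
  have hw : ∀ᵐ x ∂(volume.restrict Ω), hw₀L.toLp w₀ x = w₀ x := MemLp.coeFn_toLp hw₀L
  have h1 := h (hw₀L.toLp w₀) (by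
    change ∀ᵐ x ∂(volume.restrict Ω), _
    filter_upwards [hw, hw₀b] with x hx hx2
    rw [hx]; exact hx2)
  have h2 : Integrable (fun x => D x * (hw₀L.toLp w₀ x - u x)) (volume.restrict Ω) := by
    refine (L2.integrable_inner (𝕜 := ℝ) g (hw₀L.toLp w₀ - u)).congr ?_
    filter_upwards [hg, Lp.coeFn_sub (hw₀L.toLp w₀) u] with x hx hx2
    rw [hx, hx2]
    simp [mul_comm]
  have h3 : ∀ᵐ x ∂(volume.restrict Ω), 0 ≤ -(D x * (hw₀L.toLp w₀ x - u x)) := by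
    filter_upwards [hw, hu'] with x hx hux
    rw [hx]
    simp only [w₀]
    split_ifs with h4 h5
    · nlinarith
    · nlinarith
    · simp
  have h4 : ∫ x in Ω, -(D x * (hw₀L.toLp w₀ x - u x)) = 0 :=
    le_antisymm (by rw [integral_neg]; linarith) (integral_nonneg_of_ae h3)
  have h5 := (integral_eq_zero_iff_of_nonneg_ae h3 h2.neg).1 h4
  filter_upwards [h5, hw] with x hx hwx
  simp only [Pi.zero_apply, neg_eq_zero, mul_eq_zero, hwx, w₀] at hx
  refine ⟨fun hpos => ?_, fun hneg => ?_⟩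
  · rw [if_pos hpos] at hx
    rcases hx with hx | hx
    · exact absurd hx hpos.ne'
    · linarith
  · rw [if_neg hneg.le.not_gt, if_pos hneg] at hx
    rcases hx with hx | hx
    · exact absurd hx hneg.ne
    · linarith

/-- The sign conditions pass to the weak limit. Combined with the sign of `𝔡` on the active sets
they give `𝔡 v ≥ 0`, and since its integral `⟪g, v⟫` is zero, `v` vanishes where `𝔡` does not. -/
theorem mem_criticalCone_of_weakTendsto {a b α : ℝ} (hab : a < b) (hΩ : Bornology.IsBounded Ω)
    {g u : L2 Ω} {y z : H10 Ω} (hg : g =ᵐ[volume.restrict Ω] reducedGradient α u y z)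
    (hu : u ∈ admissible Ω a b)
    (h : ∀ w ∈ admissible Ω a b, 0 ≤ ∫ x in Ω, reducedGradient α u y z x * (w x - u x))
    {w : ℕ → L2 Ω} {t : ℕ → ℝ} {v : L2 Ω} (hw : ∀ n, w n ∈ admissible Ω a b)
    (ht : ∀ n, 0 < t n) (hv : WeakTendsto (fun n => t n • (w n - u)) v) (hgv : ⟪g, v⟫ = 0) :
    v ∈ criticalCone α a b u y z := by
  have hcoe : ∀ n, ∀ᵐ x ∂(volume.restrict Ω),
      (t n • (w n - u) : L2 Ω) x = t n * (w n x - u x) := fun n => by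
    filter_upwards [Lp.coeFn_smul (t n) (w n - u), Lp.coeFn_sub (w n) u] with x h1 h2
    rw [h1, Pi.smul_apply, h2]
    rfl
  have hmu := (Lp.stronglyMeasurable u).measurable
  have hsa := ae_nonneg_of_weakTendsto hΩ hv (hmu (measurableSet_singleton a)) (fun n => by
    have hwn : ∀ᵐ x ∂(volume.restrict Ω), a ≤ w n x ∧ w n x ≤ b := hw n
    filter_upwards [hcoe n, hwn] with x hx hx2 hxa
    rw [hx, show u x = a from hxa]
    exact mul_nonneg (ht n).le (by linarith))
  have hsb := ae_nonneg_of_weakTendsto hΩ (hv.map (-ContinuousLinearMap.id ℝ (L2 Ω)))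
    (hmu (measurableSet_singleton b)) (fun n => by
    have hwn : ∀ᵐ x ∂(volume.restrict Ω), a ≤ w n x ∧ w n x ≤ b := hw n
    filter_upwards [hcoe n, hwn, Lp.coeFn_neg (t n • (w n - u))] with x hx hx2 hx3 hxb
    change 0 ≤ (-(t n • (w n - u)) : L2 Ω) x
    rw [hx3, Pi.neg_apply, hx, show u x = b from hxb]
    have := mul_nonneg (ht n).le (show 0 ≤ b - w n x by linarith)
    linarith)
  have hsign := ae_eq_of_variationalInequality hab hΩ (measurable_reducedGradient α u y z) hg hu h
  have hneg : ∀ᵐ x ∂(volume.restrict Ω), (-v : L2 Ω) x = -v x := Lp.coeFn_neg v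
  have hsb' : ∀ᵐ x ∂(volume.restrict Ω), u x = b → v x ≤ 0 := by
    filter_upwards [hsb, hneg] with x hx hx2 hxb
    have h1 : 0 ≤ (-v : L2 Ω) x := hx hxb
    rw [hx2] at h1
    linarith
  have hprod : ∀ᵐ x ∂(volume.restrict Ω), 0 ≤ reducedGradient α u y z x * v x := by
    filter_upwards [hsa, hsb', hsign] with x h1 h2 h3
    rcases lt_trichotomy (reducedGradient α u y z x) 0 with h0 | h0 | h0
    · exact mul_nonneg_of_nonpos_of_nonpos h0.le (h2 (h3.2 h0))
    · simp [h0]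
    · exact mul_nonneg h0.le (h1 (h3.1 h0))
  have hcongr : (fun x => ⟪g x, v x⟫) =ᵐ[volume.restrict Ω]
      fun x => reducedGradient α u y z x * v x := by
    filter_upwards [hg] with x hx
    rw [hx]
    simp [mul_comm]
  have hzero := (integral_eq_zero_iff_of_nonneg_ae hprod
    ((L2.integrable_inner (𝕜 := ℝ) g v).congr hcongr)).1 (by
      rw [← integral_congr_ae hcongr, ← L2.inner_def, hgv])
  change ∀ᵐ x ∂(volume.restrict Ω), _
  filter_upwards [hsa, hsb', hzero] with x h1 h2 h3
  refine ⟨h1, h2, fun hne => ?_⟩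
  exact (mul_eq_zero.1 h3).resolve_left hne

end BilinearStokesBrinkman

end

/-! ### The main theorem -/

open BilinearStokesBrinkman in
theorem mainTheorem6 {d : ℕ} (hd : d = 2 ∨ d = 3)
    {Ω : Set (BilinearStokesBrinkman.Vec d)} (hΩ : BilinearStokesBrinkman.IsLipschitzDomain Ω)
    (f : BilinearStokesBrinkman.HNegOne Ω) (yΩ : BilinearStokesBrinkman.L2Vec Ω)
    {α a b : ℝ} (hα : 0 < α) (ha : 0 < a) (hab : a < b)
    {ubar : BilinearStokesBrinkman.L2 Ω} {ybar zbar : BilinearStokesBrinkman.H10 Ω}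
    (hubar : ubar ∈ BilinearStokesBrinkman.admissible Ω a b)
    (hfirst : BilinearStokesBrinkman.FirstOrderConditions f α yΩ a b ubar ybar zbar)
    (hsecond : ∀ v ∈ BilinearStokesBrinkman.criticalCone α a b ubar ybar zbar, v ≠ 0 →
      0 < BilinearStokesBrinkman.secondDeriv f α yΩ ubar v) :
    ∃ δ > 0, ∃ σ > 0, ∀ u ∈ BilinearStokesBrinkman.admissible Ω a b, ‖u - ubar‖ ≤ δ →
      BilinearStokesBrinkman.reducedCost f α yΩ u ≥
        BilinearStokesBrinkman.reducedCost f α yΩ ubar + σ / 2 * ‖u - ubar‖ ^ 2 := by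
  have hbd := hΩ.isBounded
  obtain ⟨V, _, _, _, e, he, hrange⟩ := exists_divFree_hilbert Ω
  have hua : ∀ᵐ x ∂(MeasureTheory.volume.restrict Ω), a ≤ ubar x :=
    Filter.Eventually.mono hubar fun x hx => hx.1
  obtain ⟨P, hP⟩ := exists_dotProduct (Ω := Ω) hd hbd
  obtain ⟨A, hA⟩ := exists_brinkmanEquiv he hP ha hua
  obtain ⟨⟨p, -, hstate, hdivy⟩, ⟨q, -, hadj, hdivz⟩, hvi⟩ := hfirst
  have hydiv := mem_divFree_of_forall_integral_eq_zero hbd hdivy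
  have hzdiv := mem_divFree_of_forall_integral_eq_zero hbd hdivz
  obtain ⟨yV, rfl⟩ := (hrange _).1 hydiv
  obtain ⟨zV, rfl⟩ := (hrange _).1 hzdiv
  -- Pressures disappear against divergence-free fields.
  have hzero : ∀ (s : L2 Ω) (v : V), ∫ x in Ω, s x * (e v).div x = 0 :=
    fun s v => integral_eq_zero_of_ae (by
      have hv : (e v).div =ᵐ[MeasureTheory.volume.restrict Ω] 0 := (hrange _).2 ⟨v, rfl⟩
      filter_upwards [hv] with x hx
      simp [hx])
  have hy : A yV = f ∘L e := by
    ext v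
    have h1 := hstate (e v)
    rw [hzero p v, sub_zero, brinkmanForm_eq hP (Filter.EventuallyEq.refl _ _)] at h1
    rw [hA]
    exact h1
  have hz : ∀ φ : V,
      A φ zV = inner ℝ ((e yV).field - yΩ) (e φ).field := by
    intro φ
    have h1 := hadj (e φ)
    rw [hzero q φ, add_zero, brinkmanForm_eq hP (Filter.EventuallyEq.refl _ _)] at h1
    rw [hA, MeasureTheory.L2.inner_def]
    refine h1.trans (MeasureTheory.integral_congr_ae ?_)
    filter_upwards [MeasureTheory.Lp.coeFn_sub (e yV).field yΩ] with x hx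
    rw [hx]
    rfl
  obtain ⟨r, hr, hinv⟩ := exists_isInvertible_add_pairingForm A (P.bilinearComp e e)
  have hgrad := coeFn_smul_sub_dotProduct hP α ubar (e yV) (e zV)
  -- For the separability of `L2 Ω`, on which weakly convergent subsequences rely.
  have : Fact ((2 : ENNReal) ≠ ⊤) := ⟨by simp⟩
  refine quadratic_growth_of_eq_perturbedCost A (P.bilinearComp e e) (f ∘L e) (fieldL Ω ∘L e) yΩ α
    ubar (j := fun u : L2 Ω => reducedCost f α yΩ u) hr
    (fun h hh => reducedCost_eq hrange hP hA (Filter.EventuallyEq.refl _ _) (hinv h hh))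
    hα hy hz (fun x hx => ?_) (fun x hx => ?_) (fun u hu => ?_)
    (fun u t v hu ht hv hlv => mem_criticalCone_of_weakTendsto hab hbd hgrad hubar hvi hu ht hv hlv)
    (fun v hv hv0 => ?_)
  · have hx' := WeakTendsto.map (F := H10 Ω) hx e
    rw [map_zero] at hx'
    exact tendsto_field_of_weakTendsto_zero hbd hx'
  · have hx' := WeakTendsto.map (F := H10 Ω) hx e
    rw [map_zero] at hx'
    exact tendsto_dotProduct_of_weakTendsto_zero hbd hP hx' (e zV)
  · refine (hvi u hu).trans (le_of_eq ?_)
    change _ = inner ℝ (α • ubar - P (e yV) (e zV)) (u - ubar)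
    rw [MeasureTheory.L2.inner_def]
    refine MeasureTheory.integral_congr_ae ?_
    filter_upwards [hgrad, MeasureTheory.Lp.coeFn_sub u ubar] with x h1 h2
    rw [h1, h2]
    simp [mul_comm]
  · rw [← secondDeriv_eq hrange hbd hP hA hy hz]
    exact hsecond v hv hv0
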